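/- Let $k$ be a field, let $X$ and $Y$ be noetherian reduced schemes of finite type over $k$, and let $f:X\to Y$ be a morphism of schemes such that there is an open covering $\mathcal{Y}$ of $Y$ for which $f^{-1}(\mathcal{Y})$ is a covering of $X$. Let $\mathcal{G}$ be a coherent sheaf on $X$ that is flat over $Y$, and let $\mathcal{J}$ be an $\mathcal{O}_X$-module that is flat over $Y$. For $q\ge 0$ let $\mathcal{E}xt^q_f(\mathcal{G},\bullet)$ denote the $q$-th right derived functor of the functor $\mathcal{H}om_f(\mathcal{G},\bullet):=f_*\circ\mathcal{H}om_{\mathcal{O}_X}(\mathcal{G},\bullet)$ from $\mathcal{O}_X$-modules to $\mathcal{O}_Y$-modules. Then there exists a first quadrant cohomological spectral sequence of abelian groups $(E_r^{p,q})_{r\ge 2}$, with differentials $d_r:E_r^{p,q}\to E_r^{p+r,q-r+1}$, such that $$E_2^{p,q}\cong H^p(Y,\mathcal{E}xt^q_f(\mathcal{G},\mathcal{J}))\qquad(p,q\ge 0)$$ and which converges to $Ext^{p+q}_X(\mathcal{G},\mathcal{J})$; that is, for every $n\ge 0$ there is a decreasing filtration $Ext^n_X(\mathcal{G},\mathcal{J})=F^0\supseteq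 F^1\supseteq\dots\supseteq F^n\supseteq F^{n+1}=0$ with $E_\infty^{p,q}\cong F^p/F^{p+1}$ whenever $p+q=n$. -/

import Mathlib

open CategoryTheory Limits AlgebraicGeometry TopologicalSpace Opposite

universe u

noncomputable section

namespace RelExt

variable {X Y : Scheme.{u}}

/-! ### The category of `𝒪_X`-modules is a Grothendieck abelian category

This gives enough injectives, hence right derived functors and `Ext`-groups (in `Type u`). -/

theorem presheafOfModules_hasExactColimitsOfShape {C : Type u} [SmallCategory C]
    (R : Cᵒᵖ ⥤ RingCat.{u}) (K : Type u) [SmallCategory K] [IsFiltered K] :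
    HasExactColimitsOfShape K (PresheafOfModules.{u} R) := by
  have : (PresheafOfModules.toPresheaf R).ReflectsIsomorphisms := inferInstance
  have : ReflectsFiniteLimits (PresheafOfModules.toPresheaf R) := ⟨fun _ _ _ => inferInstance⟩
  exact HasExactColimitsOfShape.domain_of_functor K (PresheafOfModules.toPresheaf R)

instance : AB5OfSize.{u, u} X.Modules where
  ofShape K _ _ := by
    have := presheafOfModules_hasExactColimitsOfShape X.ringCatSheaf.obj K
    exact (PresheafOfModules.sheafificationAdjunction
      (𝟙 X.ringCatSheaf.obj)).hasExactColimitsOfShape K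

instance : HasSeparator X.Modules where
  hasSeparator := by
    let adj := PresheafOfModules.sheafificationAdjunction (𝟙 X.ringCatSheaf.obj)
    let S : X.Opens → X.Modules := fun U =>
      (PresheafOfModules.sheafification (𝟙 X.ringCatSheaf.obj)).obj
        ((PresheafOfModules.free _).obj (yoneda.obj U))
    have hS : ObjectProperty.IsSeparating (.ofObj S) := by
      intro M N f g h
      refine Functor.map_injective (SheafOfModules.forget X.ringCatSheaf) ?_
      refine PresheafOfModules.freeYoneda.isSeparating _ _ _ ?_
      rintro _ ⟨U⟩ a
      apply (adj.homEquiv _ _).symm.injective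
      have := h _ (ObjectProperty.ofObj_apply _ U) ((adj.homEquiv _ _).symm a)
      exact (adj.homEquiv_naturality_right_symm a f).trans
        (this.trans (adj.homEquiv_naturality_right_symm a g).symm)
    exact ⟨_, hS.isSeparator_coproduct⟩

instance : IsGrothendieckAbelian.{u} X.Modules where

/-! ### The sheaf `ℋom(G, J)` -/

/-- `Hom_{𝒪_U}(G|_U, J|_U)`: the families of `Γ(X, V)`-linear maps `Γ(G, V) → Γ(J, V)`, for all
open subsets `V` of `U`, which are compatible with restriction. -/
def localHom (G J : X.Modules) (U : X.Opens) :
    AddSubgroup (∀ V : {V : X.Opens // V ≤ U}, Γ(G, V.1) →ₗ[Γ(X, V.1)] Γ(J, V.1)) where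
  carrier := {φ | ∀ (V W : {V : X.Opens // V ≤ U}) (i : W.1 ⟶ V.1) (s : Γ(G, V.1)),
    φ W (G.presheaf.map i.op s) = J.presheaf.map i.op (φ V s)}
  zero_mem' := by intro V W i s; simp
  add_mem' := by intro φ ψ hφ hψ V W i s; simp [hφ V W i s, hψ V W i s]
  neg_mem' := by intro φ hφ V W i s; simp [hφ V W i s]

/-- Restriction of a section over an open `U` to a smaller open `V`. -/
abbrev res {U V : X.Opens} (h : V ≤ U) (r : Γ(X, U)) : Γ(X, V) := X.presheaf.map (homOfLE h).op r

theorem res_res {U V W : X.Opens} (h : W ≤ V) (h' : V ≤ U) (r : Γ(X, U)) :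
    res h (res h' r) = res (h.trans h') r := by
  simp only [res, ← ConcreteCategory.comp_apply, ← Functor.map_comp]
  rfl

/-- `Γ(X, U)` acts on `Hom_{𝒪_U}(G|_U, J|_U)` by `(r • φ)_V = r|_V • φ_V`. -/
instance (G J : X.Modules) (U : X.Opens) : Module Γ(X, U) (localHom G J U) where
  smul r φ := ⟨fun V => res V.2 r • φ.1 V, by
    intro V W i s
    have h : res W.2 r = X.presheaf.map i.op (res V.2 r) := (res_res i.le V.2 r).symm
    simp only [LinearMap.smul_apply, φ.2 V W i s, h, Scheme.Modules.map_smul]⟩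
  one_smul φ := by
    ext V s
    exact (congrArg (· • φ.1 V s) (map_one (X.presheaf.map (homOfLE V.2).op).hom)).trans
      (one_smul _ _)
  mul_smul r r' φ := by
    ext V s
    exact (congrArg (· • φ.1 V s) (map_mul (X.presheaf.map (homOfLE V.2).op).hom r r')).trans
      (mul_smul _ _ _)
  smul_zero r := by
    ext V s
    exact smul_zero (res V.2 r)
  smul_add r φ ψ := by
    ext V s
    exact smul_add (res V.2 r) (φ.1 V s) (ψ.1 V s)
  add_smul r r' φ := by
    ext V s
    exact (congrArg (· • φ.1 V s) (map_add (X.presheaf.map (homOfLE V.2).op).hom r r')).trans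
      (add_smul _ _ _)
  zero_smul φ := by
    ext V s
    exact (congrArg (· • φ.1 V s) (map_zero (X.presheaf.map (homOfLE V.2).op).hom)).trans
      (zero_smul _ _)

theorem smul_localHom_apply {G J : X.Modules} {U : X.Opens} (r : Γ(X, U)) (φ : localHom G J U)
    (V : {V : X.Opens // V ≤ U}) (s : Γ(G, V.1)) :
    (r • φ).1 V s = res V.2 r • φ.1 V s := rfl

/-- Restriction `Hom_{𝒪_U}(G|_U, J|_U) → Hom_{𝒪_V}(G|_V, J|_V)` for `V ≤ U`. -/
def localHomRes (G J : X.Modules) {U V : X.Opens} (h : V ≤ U) :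
    localHom G J U →+ localHom G J V where
  toFun φ := ⟨fun W => φ.1 ⟨W.1, W.2.trans h⟩, fun W W' i s => φ.2 ⟨W.1, _⟩ ⟨W'.1, _⟩ i s⟩
  map_zero' := rfl
  map_add' _ _ := rfl

/-- The presheaf of abelian groups `U ↦ Hom_{𝒪_U}(G|_U, J|_U)`. -/
def homPresheaf (G J : X.Modules) : TopCat.Presheaf Ab X where
  obj U := AddCommGrpCat.of (localHom G J U.unop)
  map i := AddCommGrpCat.ofHom (localHomRes G J i.unop.le)
  map_id _ := rfl
  map_comp _ _ := rfl

instance (G J : X.Modules) (U : (Opens X)ᵒᵖ) :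
    Module (X.ringCatSheaf.obj.obj U) ((homPresheaf G J).obj U) :=
  inferInstanceAs (Module Γ(X, U.unop) (localHom G J U.unop))

theorem homPresheaf_map_apply {G J : X.Modules} {U V : (Opens X)ᵒᵖ} (i : U ⟶ V)
    (φ : localHom G J U.unop) (W : {W : X.Opens // W ≤ V.unop}) :
    ((homPresheaf G J).map i φ : localHom G J V.unop).1 W = φ.1 ⟨W.1, W.2.trans i.unop.le⟩ := rfl

theorem homPresheaf_isSheaf (G J : X.Modules) : (homPresheaf G J).IsSheaf := by
  rw [TopCat.Presheaf.isSheaf_iff_isSheafUniqueGluing]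
  intro ι U sf hsf
  let Js : TopCat.Sheaf Ab X := ⟨J.presheaf, J.isSheaf⟩
  have hJm {V W Z : X.Opens} (i : W ⟶ V) (j : Z ⟶ W) (k : Z ⟶ V) (t : Γ(J, V)) :
      J.presheaf.map j.op (J.presheaf.map i.op t) = J.presheaf.map k.op t := by
    rw [← ConcreteCategory.comp_apply, ← Functor.map_comp]; rfl
  have hGm {V W Z : X.Opens} (i : W ⟶ V) (j : Z ⟶ W) (k : Z ⟶ V) (t : Γ(G, V)) :
      G.presheaf.map j.op (G.presheaf.map i.op t) = G.presheaf.map k.op t := by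
    rw [← ConcreteCategory.comp_apply, ← Functor.map_comp]; rfl
  let f (i : ι) : localHom G J (U i) := sf i
  have hf (i j : ι) (W : X.Opens) (hi : W ≤ U i) (hj : W ≤ U j) :
      (f i).1 ⟨W, hi⟩ = (f j).1 ⟨W, hj⟩ := by
    have := congrArg (fun φ : localHom G J (U i ⊓ U j) => φ.1 ⟨W, le_inf hi hj⟩) (hsf i j)
    exact this
  have hcov (V : {V : X.Opens // V ≤ iSup U}) : V.1 ≤ ⨆ i, V.1 ⊓ U i := by
    rw [← inf_iSup_eq]; exact le_inf le_rfl V.2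
  -- the local sections to be glued
  let loc (V : {V : X.Opens // V ≤ iSup U}) (s : Γ(G, V.1)) (i : ι) : Γ(J, V.1 ⊓ U i) :=
    (f i).1 ⟨V.1 ⊓ U i, inf_le_right⟩ (G.presheaf.map (homOfLE inf_le_left).op s)
  have hloc (V : {V : X.Opens // V ≤ iSup U}) (s : Γ(G, V.1)) (i : ι) (W : X.Opens)
      (k : W ⟶ V.1 ⊓ U i) (hW : W ≤ V.1) :
      J.presheaf.map k.op (loc V s i) = (f i).1 ⟨W, k.le.trans inf_le_right⟩
        (G.presheaf.map (homOfLE hW).op s) := by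
    have h := (f i).2 ⟨V.1 ⊓ U i, inf_le_right⟩ ⟨W, k.le.trans inf_le_right⟩ k
      (G.presheaf.map (homOfLE inf_le_left).op s)
    rw [hGm (homOfLE inf_le_left) k (homOfLE hW)] at h
    exact h.symm
  have hex (V : {V : X.Opens // V ≤ iSup U}) (s : Γ(G, V.1)) :
      ∃ t : Γ(J, V.1), ∀ i, J.presheaf.map (homOfLE inf_le_left).op t = loc V s i := by
    obtain ⟨t, ht, -⟩ := Js.existsUnique_gluing' (fun i => V.1 ⊓ U i) V.1
      (fun i => homOfLE inf_le_left) (hcov V) (loc V s) (by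
        intro i j
        refine (hloc V s i _ _ (inf_le_left.trans inf_le_left)).trans ?_
        refine Eq.trans ?_ (hloc V s j _ _ (inf_le_left.trans inf_le_left)).symm
        rw [hf i j])
    exact ⟨t, ht⟩
  have hsep (V : {V : X.Opens // V ≤ iSup U}) (t t' : Γ(J, V.1))
      (h : ∀ i, J.presheaf.map (homOfLE (inf_le_left : V.1 ⊓ U i ≤ V.1)).op t =
        J.presheaf.map (homOfLE (inf_le_left : V.1 ⊓ U i ≤ V.1)).op t') : t = t' :=
    Js.eq_of_locally_eq' (fun i => V.1 ⊓ U i) V.1 (fun i => homOfLE inf_le_left) (hcov V) t t' h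
  choose t ht using hex
  let g : localHom G J (iSup U) := ⟨fun V =>
    { toFun := t V
      map_add' := by
        intro s s'
        refine hsep V _ _ fun i => ?_
        simp only [map_add, ht, loc]
      map_smul' := by
        intro r s
        refine hsep V _ _ fun i => ?_
        simp only [RingHom.id_apply, Scheme.Modules.map_smul, ht, loc, map_smul] }, by
    intro V W k s
    refine hsep W _ _ fun i => ?_
    refine (ht W _ i).trans ?_
    change (f i).1 _ (G.presheaf.map _ (G.presheaf.map k.op s)) =
      J.presheaf.map _ (J.presheaf.map k.op (t V s))
    have hWV : W.1 ⊓ U i ≤ V.1 ⊓ U i := inf_le_inf_right _ k.le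
    rw [hJm k (homOfLE inf_le_left) (homOfLE (inf_le_left.trans k.le)),
      ← hJm (homOfLE inf_le_left) (homOfLE hWV), ht, hGm k (homOfLE inf_le_left)
      (homOfLE (inf_le_left.trans k.le)), hloc V s i _ _ (inf_le_left.trans k.le)]⟩
  refine ⟨g, ?_, ?_⟩
  · intro i
    refine Subtype.ext (funext fun V => LinearMap.ext fun s => ?_)
    have hV : V.1 ≤ V.1 ⊓ U i := le_inf le_rfl V.2
    change t ⟨V.1, _⟩ s = (f i).1 V s
    have h := congrArg (J.presheaf.map (homOfLE hV).op) (ht ⟨V.1, V.2.trans (le_iSup U i)⟩ s i)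
    rw [hJm (homOfLE inf_le_left) (homOfLE hV) (𝟙 _), hloc ⟨V.1, V.2.trans (le_iSup U i)⟩ s i V.1
      (homOfLE hV) le_rfl] at h
    have h1 (M : X.Modules) (x : Γ(M, V.1)) : M.presheaf.map (𝟙 V.1).op x = x := by simp
    rw [h1] at h
    refine h.trans ?_
    exact congrArg ((f i).1 V) (h1 G s)
  · intro g' hg'
    let g'' : localHom G J (iSup U) := g'
    refine Subtype.ext (funext fun V => LinearMap.ext fun s => ?_)
    change g''.1 V s = t V s
    refine hsep V _ _ fun i => ?_
    rw [ht]
    have h := congrArg (fun φ : localHom G J (U i) => φ.1 ⟨V.1 ⊓ U i, inf_le_right⟩) (hg' i)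
    have h' : g''.1 ⟨V.1 ⊓ U i, inf_le_left.trans V.2⟩ = (f i).1 ⟨V.1 ⊓ U i, inf_le_right⟩ := h
    rw [← g''.2 V ⟨V.1 ⊓ U i, inf_le_left.trans V.2⟩ (homOfLE inf_le_left) s, h']

/-- The `𝒪_X`-module `ℋom(G, J)`. -/
def homModule (G J : X.Modules) : X.Modules :=
  SheafOfModules.mk (R := X.ringCatSheaf)
    (PresheafOfModules.ofPresheaf (homPresheaf G J) (by
      intro U V i r φ
      refine Subtype.ext (funext fun W => LinearMap.ext fun s => ?_)
      exact congrArg (· • (φ : localHom G J U.unop).1 ⟨W.1, W.2.trans i.unop.le⟩ s)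
        (res_res W.2 i.unop.le r).symm))
    (homPresheaf_isSheaf G J)

/-- Composition `Hom_{𝒪_U}(G|_U, J|_U) → Hom_{𝒪_U}(G|_U, J'|_U)` with a morphism `α : J ⟶ J'`. -/
def localHomMap (G : X.Modules) {J J' : X.Modules} (α : J ⟶ J') (U : X.Opens) :
    localHom G J U →ₗ[Γ(X, U)] localHom G J' U where
  toFun φ := ⟨fun V =>
    { toFun s := α.app V.1 (φ.1 V s)
      map_add' := by simp
      map_smul' := by simp }, by
    intro V W i s
    change α.app W.1 (φ.1 W (G.presheaf.map i.op s)) = J'.presheaf.map i.op (α.app V.1 (φ.1 V s))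
    rw [φ.2 V W i s]
    exact ConcreteCategory.congr_hom (α.mapPresheaf.naturality i.op) (φ.1 V s)⟩
  map_add' φ ψ := by
    ext V s
    exact map_add (α.app V.1).hom (φ.1 V s) (ψ.1 V s)
  map_smul' r φ := by
    ext V s
    exact Scheme.Modules.Hom.app_smul α (res V.2 r) (φ.1 V s)

/-- The functor `ℋom(G, -)` from `𝒪_X`-modules to `𝒪_X`-modules; a morphism `J ⟶ J'` acts by
composition. -/
def sheafHom (G : X.Modules) : X.Modules ⥤ X.Modules where
  obj J := homModule G J
  map {J J'} α := ⟨PresheafOfModules.homMk (M₁ := (homModule G J).val) (M₂ := (homModule G J').val)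
    { app U := AddCommGrpCat.ofHom (localHomMap G α U.unop).toAddMonoidHom
      naturality _ _ _ := rfl }
    (fun U r φ => (localHomMap G α U.unop).map_smul r φ)⟩
  map_id _ := rfl
  map_comp _ _ := rfl

instance (G : X.Modules) : (sheafHom G).Additive where
  map_add := rfl

/-! ### Relative `Ext`-sheaves, `Ext`-groups and cohomology -/

/-- The functor `ℋom_f(G, -) = f_* ∘ ℋom(G, -)`. -/
def relHom (f : X ⟶ Y) (G : X.Modules) : X.Modules ⥤ Y.Modules :=
  sheafHom G ⋙ Scheme.Modules.pushforward f

instance (f : X ⟶ Y) (G : X.Modules) : (relHom f G).Additive :=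
  inferInstanceAs (sheafHom G ⋙ Scheme.Modules.pushforward f).Additive

/-- `ℰxt^q_f(G, -)`, the `q`-th right derived functor of `ℋom_f(G, -)`, evaluated at `J`. -/
def relExt (f : X ⟶ Y) (G : X.Modules) (q : ℕ) (J : X.Modules) : Y.Modules :=
  ((relHom f G).rightDerived q).obj J

/-- `H^p(Y, M)`: sheaf cohomology of the abelian sheaf underlying the `𝒪_Y`-module `M`. -/
abbrev cohomology (M : Y.Modules) (p : ℕ) : Type u :=
  ((SheafOfModules.toSheaf Y.ringCatSheaf).obj M).H p

/-! ### Coherence and flatness -/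

/-- Coherent modules on a (locally) noetherian scheme: quasi-coherent and of finite type. -/
def IsCoherent (M : X.Modules) : Prop :=
  SheafOfModules.IsQuasicoherent.{u} (R := X.ringCatSheaf) M ∧
    SheafOfModules.IsFiniteType.{u} (R := X.ringCatSheaf) M

/-- The stalk `M_x` of an `𝒪_X`-module. -/
abbrev stalk (M : X.Modules) (x : X) : Ab := TopCat.Presheaf.stalk M.presheaf x

/-- The `𝒪_{X,x}`-module structure of `M_x`. -/
instance (M : X.Modules) (x : X) : Module (X.presheaf.stalk x) (stalk M x) :=
  PresheafOfModules.instModuleCarrierStalkCommRingCatCarrierAbPresheafOpensCarrier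
    (R := X.presheaf) M.val x

/-- `M` is flat over `Y`: for every `x`, the stalk `M_x` is flat over `𝒪_{Y, f(x)}`. -/
def IsFlatOver (f : X ⟶ Y) (M : X.Modules) : Prop :=
  ∀ x : X,
    letI : Module (Y.presheaf.stalk (f x)) (stalk M x) := Module.compHom _ (f.stalkMap x).hom
    Module.Flat (Y.presheaf.stalk (f x)) (stalk M x)

/-! ### Convergence -/

/-- Convergence of a first quadrant cohomological spectral sequence `E` to a family of abelian
groups `A n`: every `A n` has a finite decreasing filtration
`A n = F⁰ ⊇ F¹ ⊇ ⋯ ⊇ Fⁿ ⊇ Fⁿ⁺¹ = 0` with `E_∞^{p,q} ≅ F^p / F^{p+1}` for `p + q = n`.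
The differentials of `E_r` into and out of the spot `(p, q)` have source and target outside the
first quadrant as soon as `p < r` and `q + 1 < r`, so that `E_∞^{p,q} = E_r^{p,q}` for such `r`. -/
def ConvergesTo (E : E₂CohomologicalSpectralSequenceNat Ab.{u}) (A : ℕ → Type u)
    [∀ n, AddCommGroup (A n)] : Prop :=
  ∀ n : ℕ, ∃ F : ℕ → AddSubgroup (A n), F 0 = ⊤ ∧ F (n + 1) = ⊥ ∧ Antitone F ∧
    ∀ (p q : ℕ), p + q = n → ∀ (r : ℤ) (hr : 2 ≤ r), (p : ℤ) < r → (q : ℤ) + 1 < r →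
      Nonempty ((E.page r hr).X (p, q) ≃+ (F p ⧸ (F (p + 1)).addSubgroupOf (F p)))

end RelExt

end

/-! Write `F` for `relHomSheaf f G`, that is, `ℋom_f(G, -)` with values in abelian sheaves on `Y`,
and `ℤ` for the constant sheaf. Global sections of `F M` are the morphisms `G ⟶ M`, so `Hom(ℤ, F M)
≅ Hom(G, M)` naturally in `M`; and `F I` is flasque for injective `I` (`isFlasque_relHomSheaf`),
hence acyclic for `Hom(ℤ, -)`. These are the inputs of a Grothendieck spectral sequence
(`exists_grothendieck_spectralSequence`).

That sequence is built in the derived category. Let `K = F(R)` for an injective resolution `R` of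
`J`. The canonical truncations of `K` give the spectral object `H^n(i ≤ j) = Hom(ℤ, τ_{≥ i} τ_{< j}
K[n])`. Since `τ_{≥ q} τ_{< q+1} K` is `H^q(K) = R^qF(J)` placed in degree `q`, the second page is
`Ext^p(ℤ, R^qF(J)) = H^p(Y, R^qF(J))`. The abutment `Hom(ℤ, K[n])` is the `n`-th cohomology of
`Hom(ℤ, K) ≅ Hom(G, R)`, because the terms of `K` are acyclic; this is `Ext^n(G, J)`.

Passing from modules to abelian sheaves is exact, so `R^qF(J)` is the sheaf underlying `relExt f G q
J` (`nonempty_rightDerived_comp_iso`). Convergence holds for any first quadrant spectral object,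
with the filtration by the images of the truncations. -/

noncomputable section

namespace RelExt

/-! ### Spectral objects -/

section SpectralObjects

open ComposableArrows Pretriangulated

universe w

/-- The image of a spectral object in a pretriangulated category by a homological functor. -/
def mapHomological {T ι A : Type*} [Category* T] [Category* ι] [Category* A] [HasZeroObject T]
    [HasShift T ℤ] [Preadditive T] [∀ n : ℤ, (shiftFunctor T n).Additive] [Pretriangulated T]
    [Abelian A] (ω : Triangulated.SpectralObject T ι) (F : T ⥤ A) [F.IsHomological]
    [F.ShiftSequence ℤ] : Abelian.SpectralObject A ι where
  H n := ω.ω₁ ⋙ F.shift n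
  δ' n₀ n₁ h :=
    { app D := F.homologySequenceδ (ω.ω₂.obj D) n₀ n₁ h
      naturality _ _ φ := F.homologySequenceδ_naturality _ _ (ω.ω₂.map φ) n₀ n₁ h }
  exact₁' n₀ n₁ h D :=
    (F.homologySequence_exact₁ _ (ω.distinguished' D) n₀ n₁ h).exact_toComposableArrows
  exact₂' n D :=
    (F.homologySequence_exact₂ _ (ω.distinguished' D) n).exact_toComposableArrows
  exact₃' n₀ n₁ h D :=
    (F.homologySequence_exact₃ _ (ω.distinguished' D) n₀ n₁ h).exact_toComposableArrows

/-- A morphism of abelian groups, transported to small models of its source and target. -/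
def shrinkHom {M N : Ab.{w}} [Small.{u} M] [Small.{u} N] (f : M ⟶ N) :
    AddCommGrpCat.of (Shrink.{u} M) ⟶ AddCommGrpCat.of (Shrink.{u} N) :=
  AddCommGrpCat.ofHom (((Shrink.addEquiv (α := N)).symm.toAddMonoidHom.comp f.hom).comp
    (Shrink.addEquiv (α := M)).toAddMonoidHom)

theorem shrinkHom_id (M : Ab.{w}) [Small.{u} M] : shrinkHom.{u} (𝟙 M) = 𝟙 _ :=
  ConcreteCategory.hom_ext _ _ fun x => (Shrink.addEquiv (α := M)).symm_apply_apply x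

theorem shrinkHom_comp {M N P : Ab.{w}} [Small.{u} M] [Small.{u} N] [Small.{u} P]
    (f : M ⟶ N) (g : N ⟶ P) : shrinkHom.{u} (f ≫ g) = shrinkHom f ≫ shrinkHom g :=
  ConcreteCategory.hom_ext _ _ fun x => congrArg (fun y => (Shrink.addEquiv (α := P)).symm (g y))
    ((Shrink.addEquiv (α := N)).apply_symm_apply (f (Shrink.addEquiv (α := M) x))).symm

theorem shrinkHom_zero (M N : Ab.{w}) [Small.{u} M] [Small.{u} N] :
    shrinkHom.{u} (0 : M ⟶ N) = 0 :=
  ConcreteCategory.hom_ext _ _ fun _ => map_zero (Shrink.addEquiv (α := N)).symm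

theorem shrinkHom_exact {M N P : Ab.{w}} [Small.{u} M] [Small.{u} N] [Small.{u} P]
    {f : M ⟶ N} {g : N ⟶ P} (h : (mk₂ f g).Exact) :
    (mk₂ (shrinkHom.{u} f) (shrinkHom.{u} g)).Exact := by
  have zero : f ≫ g = 0 := h.toIsComplex.zero 0
  have h' := (ShortComplex.ab_exact_iff _).1 (h.exact 0)
  have zero' : shrinkHom.{u} f ≫ shrinkHom.{u} g = 0 := by
    rw [← shrinkHom_comp, zero, shrinkHom_zero]
  refine ShortComplex.Exact.exact_toComposableArrows
    (S := ShortComplex.mk (shrinkHom.{u} f) (shrinkHom.{u} g) zero') ?_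
  rw [ShortComplex.ab_exact_iff]
  intro x hx
  obtain ⟨y, hy⟩ := h' (Shrink.addEquiv (α := N) x) (by
    have := congrArg (Shrink.addEquiv (α := P)) hx
    exact (AddEquiv.apply_symm_apply _ _).symm.trans (this.trans (map_zero _)))
  refine ⟨(Shrink.addEquiv (α := M)).symm y, ?_⟩
  refine (congrArg (fun z => (Shrink.addEquiv (α := N)).symm (f z))
    ((Shrink.addEquiv (α := M)).apply_symm_apply y)).trans ?_
  exact (congrArg _ hy).trans (AddEquiv.symm_apply_apply _ _)

/-- A functor to abelian groups with small values, transported to small models. -/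
def shrinkFunctor {C : Type*} [Category* C] (F : C ⥤ Ab.{w}) (hF : ∀ D, Small.{u} (F.obj D)) :
    C ⥤ Ab.{u} where
  obj D := AddCommGrpCat.of (Shrink.{u} (F.obj D))
  map φ := shrinkHom (F.map φ)
  map_id D := by rw [← shrinkHom_id]; exact congrArg shrinkHom (F.map_id D)
  map_comp φ ψ := by rw [← shrinkHom_comp]; exact congrArg shrinkHom (F.map_comp φ ψ)

/-- A spectral object consisting of small abelian groups, transported to small models. -/
def shrinkSpectralObject {ι : Type*} [Category* ι] (X : Abelian.SpectralObject Ab.{w} ι)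
    (hX : ∀ n D, Small.{u} ((X.H n).obj D)) : Abelian.SpectralObject Ab.{u} ι where
  H n := shrinkFunctor (X.H n) (hX n)
  δ' n₀ n₁ h :=
    { app D := shrinkHom.{u} (M := (X.H n₀).obj ((functorArrows ι 1 2 2).obj D))
        (N := (X.H n₁).obj ((functorArrows ι 0 1 2).obj D)) ((X.δ' n₀ n₁ h).app D)
      naturality D D' φ := by
        refine (shrinkHom_comp _ _).symm.trans (Eq.trans ?_ (shrinkHom_comp _ _))
        exact congrArg shrinkHom ((X.δ' n₀ n₁ h).naturality φ) }
  exact₁' n₀ n₁ h D := shrinkHom_exact (X.exact₁' n₀ n₁ h D)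
  exact₂' n D := shrinkHom_exact (X.exact₂' n D)
  exact₃' n₀ n₁ h D := shrinkHom_exact (X.exact₃' n₀ n₁ h D)

end SpectralObjects

/-! ### Convergence of the spectral sequence of a spectral object -/

section Convergence

open ComposableArrows Abelian

/-- `E` is the image of `v ∘ u`, and the image of `u` modulo `ker v = im w` is the same group: both
are quotients of `B` by the same kernel. -/
theorem nonempty_addEquiv_range_quotient {A B C E T : Type*} [AddCommGroup A] [AddCommGroup B]
    [AddCommGroup C] [AddCommGroup E] [AddCommGroup T] (w : A →+ T) (u : B →+ T) (v : T →+ C)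
    (e : B →+ E) (m : E →+ C) (he : Function.Surjective e) (hm : Function.Injective m)
    (h : ∀ b, m (e b) = v (u b)) (hv : ∀ t, v t = 0 ↔ t ∈ w.range) :
    Nonempty (E ≃+ u.range ⧸ w.range.addSubgroupOf u.range) := by
  let φ : B →+ u.range ⧸ w.range.addSubgroupOf u.range :=
    (QuotientAddGroup.mk' _).comp u.rangeRestrict
  have hφ : Function.Surjective φ :=
    (QuotientAddGroup.mk'_surjective _).comp u.rangeRestrict_surjective
  have hker : e.ker = φ.ker := by
    ext b
    have h1 : φ b = 0 ↔ u b ∈ w.range :=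
      (QuotientAddGroup.eq_zero_iff _).trans AddSubgroup.mem_addSubgroupOf
    rw [AddMonoidHom.mem_ker, AddMonoidHom.mem_ker, h1, ← hv, ← h, map_eq_zero_iff m hm]
  exact ⟨(QuotientAddGroup.quotientKerEquivOfSurjective e he).symm.trans
    ((QuotientAddGroup.quotientAddEquivOfEq hker).trans
      (QuotientAddGroup.quotientKerEquivOfSurjective φ hφ))⟩

variable (Z : SpectralObject Ab.{u} EInt)

/-- The map `H^n(⊥ ≤ i) ⟶ H^n(⊥ ≤ ⊤)`. -/
def toAbutment (n : ℤ) (i : EInt) :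
    (Z.H n).obj (mk₁ (homOfLE (bot_le : ⊥ ≤ i))) ⟶
      (Z.H n).obj (mk₁ (homOfLE (bot_le : ⊥ ≤ (⊤ : EInt)))) :=
  (Z.H n).map (twoδ₂Toδ₁ _ (homOfLE le_top) _ rfl)

theorem toAbutment_range_mono (n : ℤ) {i j : EInt} (h : i ≤ j) :
    (toAbutment Z n i).hom.range ≤ (toAbutment Z n j).hom.range := by
  have : toAbutment Z n i = (Z.H n).map (twoδ₂Toδ₁ _ (homOfLE h) _ rfl) ≫ toAbutment Z n j :=
    ((Z.H n).map_comp _ _)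
  rw [this]
  rintro _ ⟨x, rfl⟩
  exact ⟨_, rfl⟩

/-- With outer indices `⊥` and `⊤`, `E` is the image of `H^n(⊥ ≤ j) ⟶ H^n(i ≤ ⊤)`. This map factors
through the abutment `H^n(⊥ ≤ ⊤)`, where the kernel of the second factor is the image of `H^n(⊥ ≤
i)`. -/
theorem nonempty_E_addEquiv (n₀ n n₂ : ℤ) (hn₀ : n₀ + 1 = n) (hn₂ : n + 1 = n₂) {i j : EInt}
    (hij : i ≤ j) {T : Type*} [AddCommGroup T]
    (ε : (Z.H n).obj (mk₁ (homOfLE (bot_le : ⊥ ≤ (⊤ : EInt)))) ≃+ T) :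
    Nonempty (Z.E (homOfLE (bot_le : ⊥ ≤ i)) (homOfLE hij) (homOfLE (le_top : j ≤ ⊤))
        n₀ n n₂ hn₀ hn₂ ≃+
      (ε.toAddMonoidHom.comp (toAbutment Z n j).hom).range ⧸
        (ε.toAddMonoidHom.comp (toAbutment Z n i).hom).range.addSubgroupOf
          (ε.toAddMonoidHom.comp (toAbutment Z n j).hom).range) := by
  let e := Z.toCycles (homOfLE (bot_le : ⊥ ≤ i)) (homOfLE hij) _ rfl n ≫
    Z.πE (homOfLE (bot_le : ⊥ ≤ i)) (homOfLE hij) (homOfLE (le_top : j ≤ ⊤)) n₀ n n₂ hn₀ hn₂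
  let m := Z.ιE (homOfLE (bot_le : ⊥ ≤ i)) (homOfLE hij) (homOfLE (le_top : j ≤ ⊤))
      n₀ n n₂ hn₀ hn₂ ≫ Z.fromOpcycles (homOfLE hij) (homOfLE (le_top : j ≤ ⊤)) _ rfl n
  let v := (Z.H n).map (twoδ₁Toδ₀ (homOfLE (bot_le : ⊥ ≤ i)) (homOfLE (le_top : i ≤ ⊤)) _ rfl)
  have hem : e ≫ m = toAbutment Z n j ≫ v := by
    dsimp only [e, m]
    rw [Category.assoc, SpectralObject.πE_ιE_assoc _ _ _ _ _ _ _ hn₀ hn₂,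
      SpectralObject.p_fromOpcycles, SpectralObject.toCycles_i_assoc, ← Functor.map_comp]
    refine Eq.trans ?_ ((Z.H n).map_comp _ _)
    rfl
  have he : Epi e := inferInstance
  have hm : Mono m := inferInstance
  refine nonempty_addEquiv_range_quotient (ε.toAddMonoidHom.comp (toAbutment Z n i).hom)
    (ε.toAddMonoidHom.comp (toAbutment Z n j).hom) (v.hom.comp ε.symm.toAddMonoidHom)
    e.hom m.hom ((AddCommGrpCat.epi_iff_surjective _).1 he)
    ((AddCommGrpCat.mono_iff_injective _).1 hm) (fun b => ?_) fun t => ?_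
  · exact (ConcreteCategory.congr_hom hem b).trans
      (congrArg v.hom (ε.symm_apply_apply _).symm)
  · constructor
    · intro ht
      obtain ⟨s, hs⟩ := (ShortComplex.ab_exact_iff _).1 (Z.exact₂ (homOfLE (bot_le : ⊥ ≤ i))
        (homOfLE (le_top : i ≤ ⊤)) _ rfl n) (ε.symm t) ht
      exact ⟨s, (congrArg ε hs).trans (ε.apply_symm_apply t)⟩
    · rintro ⟨s, rfl⟩
      exact (congrArg v.hom (ε.symm_apply_apply _)).trans
        (ConcreteCategory.congr_hom (Z.zero₂ (homOfLE (bot_le : ⊥ ≤ i))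
          (homOfLE (le_top : i ≤ ⊤)) _ rfl n) s)

/-- The spectral sequence of a first quadrant spectral object converges. -/
theorem convergesTo_E₂SpectralSequenceNat [Z.IsFirstQuadrant] (A : ℕ → Type u)
    [∀ n, AddCommGroup (A n)]
    (e : ∀ n : ℕ, (Z.H n).obj (mk₁ (homOfLE (bot_le : ⊥ ≤ (⊤ : EInt)))) ≃+ A n) :
    ConvergesTo Z.E₂SpectralSequenceNat A := by
  intro n
  let F' (i : ℤ) : AddSubgroup (A n) :=
    ((e n).toAddMonoidHom.comp (toAbutment Z n (i : EInt)).hom).range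
  -- The truncation `τ_{< i}` is strict, so `F^p`, the image of the part in degrees `≤ n - p`, has
  -- index `n - p + 1`.
  let F (p : ℕ) : AddSubgroup (A n) := F' (n - p + 1)
  refine ⟨F, ?_, ?_, ?_, ?_⟩
  · have : Epi (toAbutment Z n ((n - (0 : ℕ) + 1 : ℤ) : EInt)) :=
      (Z.exact₂ _ _ _ rfl n).epi_f ((Z.isZero₂_of_isFirstQuadrant _ _ le_top n
        (by simp [WithBotTop.coe_lt_coe])).eq_of_tgt _ _)
    have h := (AddCommGrpCat.epi_iff_surjective _).1 this
    refine (AddSubgroup.eq_top_iff' _).2 fun x => ?_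
    obtain ⟨y, hy⟩ := h ((e n).symm x)
    exact ⟨y, (congrArg (e n) hy).trans ((e n).apply_symm_apply x)⟩
  · refine (AddSubgroup.eq_bot_iff_forall _).2 ?_
    rintro _ ⟨y, rfl⟩
    have h := Z.isZero₁_of_isFirstQuadrant ⊥ ((n - (n + 1 : ℕ) + 1 : ℤ) : EInt) bot_le
      (by simp) n
    have h' : toAbutment Z n ((n - (n + 1 : ℕ) + 1 : ℤ) : EInt) = 0 := h.eq_of_src _ _
    exact (congrArg (e n) (ConcreteCategory.congr_hom h' y)).trans (map_zero (e n))
  · intro p p' hp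
    rintro _ ⟨y, rfl⟩
    have h : ((n - p' + 1 : ℤ) : EInt) ≤ ((n - p + 1 : ℤ) : EInt) := by
      rw [WithBotTop.coe_le_coe]
      lia
    obtain ⟨z, hz⟩ := toAbutment_range_mono Z n h ⟨y, rfl⟩
    exact ⟨z, congrArg (e n) hz⟩
  · intro p q hpq r hr hp hq
    -- `E_r^{p,q}` is the term `E` of the chain `q - r + 2 ≤ q ≤ q + 1 ≤ q + r - 1`. The bound `q +
    -- 1 < r` makes the lowest index `≤ 0`, so it may be replaced by `⊥`; the bound `p < r` gives `n
    -- - 1 < q + r - 1`, so the highest may be replaced by `⊤`.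
    have hi₀ : ((q - r + 2 : ℤ) : EInt) ≤ ((q : ℤ) : EInt) := by
      rw [WithBotTop.coe_le_coe]; lia
    have hi₁ : ((q : ℤ) : EInt) ≤ ((q + 1 : ℤ) : EInt) := by
      rw [WithBotTop.coe_le_coe]; lia
    have hi₂ : ((q + 1 : ℤ) : EInt) ≤ ((q + r - 1 : ℤ) : EInt) := by
      rw [WithBotTop.coe_le_coe]; lia
    have e₁ := Z.spectralSequencePageXIso SpectralObject.coreE₂CohomologicalNat r hr (p, q) _ _ _ _
      rfl rfl rfl rfl (n - 1) n (n + 1) (by simp [← hpq])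
    have e₂ := Z.isoMapFourδ₁Toδ₀' ⊥ _ _ _ _ bot_le hi₀ hi₁ hi₂ (n - 1) n (n + 1)
      (Z.isZero₁_of_isFirstQuadrant _ _ _ (by rw [WithBotTop.coe_le_coe]; lia) _)
    have e₃ := Z.isoMapFourδ₄Toδ₃' ⊥ _ _ _ ⊤ bot_le hi₁ hi₂ le_top (n - 1) n (n + 1)
      (Z.isZero₂_of_isFirstQuadrant _ _ _ _ (by rw [WithBotTop.coe_lt_coe]; lia))
    obtain ⟨e₄⟩ := nonempty_E_addEquiv Z (n - 1) n (n + 1) (by lia) (by lia) hi₁ (e n)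
    have h₁ : F p = F' (q + 1) := congrArg F' (by lia)
    have h₂ : F (p + 1) = F' q := congrArg F' (by lia)
    rw [h₁, h₂]
    exact ⟨(e₁ ≪≫ e₂.symm ≪≫ e₃).addCommGroupIsoToAddEquiv.trans e₄⟩

end Convergence

/-! ### The spectral object of morphisms into the truncations of an object -/

section DerivedCategory

open ComposableArrows Abelian Pretriangulated DerivedCategory Triangulated

universe v w

variable {C : Type*} [Category.{v} C] [Abelian C] [HasDerivedCategory.{w} C]

theorem exists_iso_Q_obj_injective [EnoughInjectives C] (X : DerivedCategory C) (d : ℤ)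
    [X.IsGE d] : ∃ (L : CochainComplex C ℤ) (_ : ∀ n, Injective (L.X n)) (_ : L.IsStrictlyGE d),
      Nonempty (X ≅ Q.obj L) := by
  obtain ⟨K, _, ⟨e⟩⟩ := X.exists_iso_Q_obj_of_isGE d
  obtain ⟨L, i, _, hL, hL'⟩ :=
    CochainComplex.Plus.modelCategoryQuillen.exists_quasiIso_injective K d
  exact ⟨L, hL, hL', ⟨e ≪≫ asIso (Q.map i)⟩⟩

/-- Into a K-injective complex, derived morphisms are homotopy classes of chain maps. -/
theorem Q_map_surjective (K L : CochainComplex C ℤ) [L.IsKInjective] :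
    Function.Surjective (Q.map : (K ⟶ L) → (Q.obj K ⟶ Q.obj L)) := by
  intro f
  obtain ⟨g, hg⟩ := (CochainComplex.IsKInjective.Qh_map_bijective _ L).surjective
    ((quotientCompQhIso C).hom.app K ≫ f ≫ (quotientCompQhIso C).inv.app L)
  obtain ⟨g, rfl⟩ := (HomotopyCategory.quotient C (.up ℤ)).map_surjective g
  refine ⟨g, ?_⟩
  have h := (quotientCompQhIso C).inv.naturality g
  rw [← cancel_epi ((quotientCompQhIso C).hom.app K)]
  have h' := (quotientCompQhIso C).hom.naturality g
  dsimp at h'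
  rw [← h', hg]
  simp

/-- Morphisms of the derived category live in the universe `w`. For bounded below `X`, chain maps to
an injective model bring them down to `v`, as is needed for a spectral sequence in `Ab.{v}`. -/
theorem small_hom_of_isGE [EnoughInjectives C] (K : CochainComplex C ℤ) (X : DerivedCategory C)
    (d : ℤ) [X.IsGE d] : Small.{v} (Q.obj K ⟶ X) := by
  obtain ⟨L, _, _, ⟨e⟩⟩ := exists_iso_Q_obj_injective X d
  have := CochainComplex.isKInjective_of_injective L d
  exact small_of_surjective (f := fun g : K ⟶ L => Q.map g ≫ e.inv) fun f => by
    obtain ⟨g, hg⟩ := Q_map_surjective K L (f ≫ e.hom)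
    exact ⟨g, by simp [hg]⟩

theorem small_single_hom_of_isGE [EnoughInjectives C] (S : C) (X : DerivedCategory C)
    (d : ℤ) (_ : X.IsGE d) : Small.{v} ((singleFunctor C 0).obj S ⟶ X) := by
  have : Small.{v} ((CochainComplex.singleFunctor C 0 ⋙ Q).obj S ⟶ X) :=
    small_hom_of_isGE ((CochainComplex.singleFunctor C 0).obj S) X d
  exact small_map (((singleFunctorIsoCompQ C 0).app S).homFromEquiv)

theorem small_single_hom_truncation [EnoughInjectives C] (S : C) (X : DerivedCategory C)
    [X.IsGE 0] (n : ℤ) (D : ComposableArrows EInt 1) :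
    Small.{v} ((singleFunctor C 0).obj S ⟶
      ((TStructure.t.spectralObject X).ω₁.obj D)⟦n⟧) := by
  have : TStructure.t.IsGE ((TStructure.t.spectralObject X).ω₁.obj D) 0 :=
    inferInstanceAs (TStructure.t.IsGE ((TStructure.t.eTruncGE.obj (D.obj 0)).obj
      ((TStructure.t.eTruncLT.obj (D.obj 1)).obj X)) 0)
  exact small_single_hom_of_isGE S _ (0 - n) (TStructure.t.isGE_shift _ 0 n (0 - n))

variable [EnoughInjectives C] (S : C) (X : DerivedCategory C) [X.IsGE 0]

/-- The spectral object `H^n(i ≤ j) = Hom(S, τ_{≥ i} τ_{< j} X[n])`. -/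
def homSpectralObject : Abelian.SpectralObject Ab.{v} EInt :=
  shrinkSpectralObject (mapHomological (TStructure.t.spectralObject X)
    (preadditiveCoyoneda.obj (op ((singleFunctor C 0).obj S)))) fun n D =>
    small_single_hom_truncation S X n D

/-- The terms of `homSpectralObject`. -/
def homSpectralObjectEquiv (n : ℤ) (D : ComposableArrows EInt 1) :
    ((homSpectralObject S X).H n).obj D ≃+
      ((singleFunctor C 0).obj S ⟶ ((TStructure.t.spectralObject X).ω₁.obj D)⟦n⟧) :=
  have := small_single_hom_truncation S X n D
  Shrink.addEquiv (α := (singleFunctor C 0).obj S ⟶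
    ((TStructure.t.spectralObject X).ω₁.obj D)⟦n⟧)

theorem isZero_homSpectralObject (n : ℤ) (D : ComposableArrows EInt 1)
    (h : Subsingleton
      ((singleFunctor C 0).obj S ⟶ ((TStructure.t.spectralObject X).ω₁.obj D)⟦n⟧)) :
    IsZero (((homSpectralObject S X).H n).obj D) :=
  have := (homSpectralObjectEquiv S X n D).injective.subsingleton
  AddCommGrpCat.isZero_of_subsingleton _

/-- For `j ≤ 0` the truncation `τ_{< j} X` is zero since `X` is in degrees `≥ 0`. For `n < i` the
object `τ_{≥ i} τ_{< j} X[n]` is in degrees `≥ 1`, so it receives no nonzero morphism from `S` in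
degree `0`. -/
instance : (homSpectralObject S X).IsFirstQuadrant where
  isZero₁ i j hij hj n := by
    refine isZero_homSpectralObject S X n _ ⟨fun f g => IsZero.eq_of_tgt ?_ f g⟩
    exact (shiftFunctor _ n).map_isZero ((TStructure.t.eTruncGE.obj i).map_isZero
      (TStructure.t.isZero_eTruncLT_obj_obj X 0 j hj))
  isZero₂ i j hij n hi := by
    have h : TStructure.t.IsGE ((TStructure.t.spectralObject X).ω₁.obj (mk₁ (homOfLE hij)))
        (n + 1) := TStructure.t.isGE_eTruncGE_obj_obj (n + 1) i (by
        induction i using WithBotTop.rec with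
        | bot => exact absurd hi (by simp)
        | coe i => simpa [WithBotTop.coe_le_coe, WithBotTop.coe_lt_coe] using hi
        | top => exact le_top) _
    have := TStructure.t.isGE_shift ((TStructure.t.spectralObject X).ω₁.obj (mk₁ (homOfLE hij)))
      (n + 1) n 1
    exact isZero_homSpectralObject S X n _ ⟨fun f g =>
      (TStructure.t.zero f 0 1).trans (TStructure.t.zero g 0 1).symm⟩

end DerivedCategory

/-! ### The second page -/

section SecondPage

open ComposableArrows Abelian Pretriangulated DerivedCategory Triangulated

universe v w

variable {C : Type*} [Category.{v} C] [Abelian C] [HasDerivedCategory.{w} C]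

theorem isIso_homologyFunctor_map_mor₁ {T : Triangle (DerivedCategory C)} (hT : T ∈ distTriang _)
    (q : ℤ) (h : T.obj₃.IsGE (q + 1)) : IsIso ((homologyFunctor C q).map T.mor₁) := by
  have : Epi ((homologyFunctor C q).map T.mor₁) :=
    (HomologySequence.epi_homologyMap_mor₁_iff T hT q).2
      ((isZero_of_isGE T.obj₃ (q + 1) q (by lia)).eq_of_tgt _ _)
  have : Mono ((homologyFunctor C q).map T.mor₁) :=
    (HomologySequence.mono_homologyMap_mor₁_iff T hT (q - 1) q).2
      ((isZero_of_isGE T.obj₃ (q + 1) (q - 1) (by lia)).eq_of_src _ _)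
  exact isIso_of_mono_of_epi _

theorem isIso_homologyFunctor_map_mor₂ {T : Triangle (DerivedCategory C)} (hT : T ∈ distTriang _)
    (q : ℤ) (h : T.obj₁.IsLE (q - 1)) : IsIso ((homologyFunctor C q).map T.mor₂) := by
  have : Mono ((homologyFunctor C q).map T.mor₂) :=
    (HomologySequence.mono_homologyMap_mor₂_iff T hT q).2
      ((isZero_of_isLE T.obj₁ (q - 1) q (by lia)).eq_of_src _ _)
  have : Epi ((homologyFunctor C q).map T.mor₂) :=
    (HomologySequence.epi_homologyMap_mor₂_iff T hT q (q + 1)).2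
      ((isZero_of_isLE T.obj₁ (q - 1) (q + 1) (by lia)).eq_of_tgt _ _)
  exact isIso_of_mono_of_epi _

/-- The double truncation is both `≥ q` and `≤ q`, so it is determined by its `H^q`, which neither
of the two truncation triangles changes. -/
theorem nonempty_truncation_iso (X : DerivedCategory C) (q : ℤ) :
    Nonempty ((TStructure.t.eTruncGE.obj q).obj
        ((TStructure.t.eTruncLT.obj ((q + 1 : ℤ) : EInt)).obj X) ≅
      (singleFunctor C q).obj ((homologyFunctor C q).obj X)) := by
  let Z := (TStructure.t.eTruncLT.obj ((q + 1 : ℤ) : EInt)).obj X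
  have h₁ := isIso_homologyFunctor_map_mor₁ (TStructure.t.eTriangleLTGE_distinguished
    ((q + 1 : ℤ) : EInt) X) q (TStructure.t.isGE_eTruncGE_obj_obj (q + 1) _ le_rfl X)
  have h₂ := isIso_homologyFunctor_map_mor₂ (TStructure.t.eTriangleLTGE_distinguished
    (q : EInt) Z) q (TStructure.t.isLE_eTruncLT_obj_obj (q - 1) (q : EInt) (by simp) Z)
  have : TStructure.t.IsLE Z q := TStructure.t.isLE_eTruncLT_obj_obj q _ le_rfl X
  have : TStructure.t.IsGE ((TStructure.t.eTruncGE.obj q).obj Z) q :=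
    TStructure.t.isGE_eTruncGE_obj_obj q _ le_rfl Z
  have : TStructure.t.IsLE ((TStructure.t.eTruncGE.obj q).obj Z) q := inferInstance
  obtain ⟨W, ⟨e⟩⟩ := exists_iso_singleFunctor_obj_of_isGE_of_isLE
    ((TStructure.t.eTruncGE.obj q).obj Z) q
  let e₁ : W ≅ (homologyFunctor C q).obj ((TStructure.t.eTruncGE.obj q).obj Z) :=
    ((singleFunctorCompHomologyFunctorIso C q).symm.app W) ≪≫ (homologyFunctor C q).mapIso e.symm
  let e₂ : (homologyFunctor C q).obj Z ≅ (homologyFunctor C q).obj X := @asIso _ _ _ _ _ h₁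
  let e₃ : (homologyFunctor C q).obj Z ≅ (homologyFunctor C q).obj
    ((TStructure.t.eTruncGE.obj q).obj Z) := @asIso _ _ _ _ _ h₂
  exact ⟨e ≪≫ (singleFunctor C q).mapIso (e₁ ≪≫ e₃.symm ≪≫ e₂)⟩

/-- Postcomposition with an isomorphism. -/
def postcompAddEquiv {D : Type*} [Category* D] [Preadditive D] (S : D) {X Y : D} (e : X ≅ Y) :
    (S ⟶ X) ≃+ (S ⟶ Y) where
  toEquiv := e.homToEquiv
  map_add' _ _ := Preadditive.add_comp ..

/-- `S^q(M)[p + q] ≅ S⁰(M)[p]`, where `S^q(M)` is `M` placed in degree `q`. -/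
def singleShiftIso (M : C) (p q : ℤ) :
    ((singleFunctor C q).obj M)⟦p + q⟧ ≅ ((singleFunctor C 0).obj M)⟦p⟧ :=
  (shiftFunctorAdd' (DerivedCategory C) q p (p + q) (by lia)).app _ ≪≫
    (shiftFunctor _ p).mapIso (((singleFunctors C).shiftIso q 0 q (by lia)).app M)

theorem nonempty_homSpectralObject_addEquiv_ext [EnoughInjectives C] [HasExt.{v} C] (S : C)
    (X : DerivedCategory C) [X.IsGE 0] (p q : ℕ) (h : ((q : ℤ) : EInt) ≤ ((q + 1 : ℤ) : EInt)) :
    Nonempty (((homSpectralObject S X).H (p + q)).obj (mk₁ (homOfLE h)) ≃+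
      Ext.{v} S ((homologyFunctor C q).obj X) p) := by
  obtain ⟨e⟩ := nonempty_truncation_iso X q
  exact ⟨(homSpectralObjectEquiv S X (p + q) (mk₁ (homOfLE h))).trans
    ((postcompAddEquiv _ ((shiftFunctor _ (p + q : ℤ)).mapIso e ≪≫
      singleShiftIso _ p q)).trans Ext.homAddEquiv.symm)⟩

/-- `E_2^{p,q}` is `H^{p+q}(q ≤ q + 1)`, that is, `Hom(S, H^q(X)[-q][p + q])`. -/
theorem nonempty_page_two_addEquiv_ext [EnoughInjectives C] [HasExt.{v} C] (S : C)
    (X : DerivedCategory C) [X.IsGE 0] (p q : ℕ) :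
    Nonempty (((homSpectralObject S X).E₂SpectralSequenceNat.page 2 le_rfl).X (p, q) ≃+
      Ext.{v} S ((homologyFunctor C q).obj X) p) := by
  obtain ⟨e⟩ := nonempty_homSpectralObject_addEquiv_ext S X p q (by simp)
  exact ⟨((homSpectralObject S X).spectralSequenceFirstPageXIso
    SpectralObject.coreE₂CohomologicalNat (p, q) _ _ rfl rfl (p + q)
      rfl).addCommGroupIsoToAddEquiv.trans e⟩

theorem convergesTo_homSpectralObject [EnoughInjectives C] (S : C)
    (X : DerivedCategory C) [X.IsGE 0] (A : ℕ → Type v) [∀ n, AddCommGroup (A n)]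
    (e : ∀ n : ℕ, ((singleFunctor C 0).obj S ⟶ X⟦(n : ℤ)⟧) ≃+ A n) :
    ConvergesTo (homSpectralObject S X).E₂SpectralSequenceNat A :=
  convergesTo_E₂SpectralSequenceNat _ _ fun n =>
    (homSpectralObjectEquiv S X n (mk₁ (homOfLE (bot_le : ⊥ ≤ (⊤ : EInt))))).trans (e n)

end SecondPage

/-! ### Cohomology classes of morphisms from a single complex -/

theorem nonempty_subquotient_addEquiv {G G' : Type*} [AddCommGroup G] [AddCommGroup G']
    (f : G →+ G') (Z B : AddSubgroup G) (Z' B' : AddSubgroup G') (hZ : ∀ z ∈ Z, f z ∈ Z')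
    (hsurj : ∀ z' ∈ Z', ∃ z ∈ Z, f z - z' ∈ B') (hinj : ∀ z ∈ Z, f z ∈ B' ↔ z ∈ B) :
    Nonempty (Z ⧸ B.addSubgroupOf Z ≃+ Z' ⧸ B'.addSubgroupOf Z') := by
  let ψ : Z →+ Z' ⧸ B'.addSubgroupOf Z' :=
    (QuotientAddGroup.mk' _).comp ((f.comp Z.subtype).codRestrict Z' fun z => hZ z z.2)
  have hψ : Function.Surjective ψ := by
    intro y
    obtain ⟨⟨z', hz'⟩, rfl⟩ := QuotientAddGroup.mk'_surjective _ y
    obtain ⟨z, hz, h⟩ := hsurj z' hz'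
    exact ⟨⟨z, hz⟩, QuotientAddGroup.eq_iff_sub_mem.2 (AddSubgroup.mem_addSubgroupOf.2 h)⟩
  have hker : B.addSubgroupOf Z = ψ.ker := by
    ext z
    have : ψ z = 0 ↔ f z ∈ B' :=
      (QuotientAddGroup.eq_zero_iff _).trans AddSubgroup.mem_addSubgroupOf
    rw [AddMonoidHom.mem_ker, this, hinj z z.2, AddSubgroup.mem_addSubgroupOf]
  exact ⟨(QuotientAddGroup.quotientAddEquivOfEq hker).trans
    (QuotientAddGroup.quotientKerEquivOfSurjective ψ hψ)⟩

section HomCohomology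

open CochainComplex HomComplex

universe v

variable {C : Type*} [Category.{v} C] [Abelian C]

/-- Composition with the differential `K.d i j`, on morphisms from `A`. -/
def homD (A : C) (K : CochainComplex C ℤ) (i j : ℤ) : (A ⟶ K.X i) →+ (A ⟶ K.X j) :=
  Preadditive.rightComp A (K.d i j)

/-- The cocycle of degree `n` from `A` (in degree `0`) to `K` given by a morphism. -/
def toCocycle (A : C) (K : CochainComplex C ℤ) (n n' : ℤ) (hn' : n + 1 = n') :
    (homD A K n n').ker →+ Cocycle ((CochainComplex.singleFunctor C 0).obj A) K n where
  toFun f := Cocycle.fromSingleMk f.1 (zero_add n) n' hn' f.2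
  map_zero' := Cocycle.fromSingleMk_zero _ _ _ _ _
  map_add' f g := Cocycle.fromSingleMk_add _ _ _ _ _ f.2 g.2

theorem toCocycle_bijective (A : C) (K : CochainComplex C ℤ) (n n' : ℤ) (hn' : n + 1 = n') :
    Function.Bijective (toCocycle A K n n' hn') := by
  refine ⟨fun f g h => ?_, fun α => ?_⟩
  · ext
    exact (Cochain.fromSingleEquiv (zero_add n)).symm.injective (congrArg Subtype.val h)
  · obtain ⟨f, hf, rfl⟩ := Cocycle.fromSingleMk_surjective α n (zero_add n) n' hn'
    exact ⟨⟨f, hf⟩, rfl⟩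

theorem toCocycle_mem_coboundaries_iff (A : C) (K : CochainComplex C ℤ) (m n n' : ℤ)
    (hm : m + 1 = n) (hn' : n + 1 = n') (f : (homD A K n n').ker) :
    toCocycle A K n n' hn' f ∈ coboundaries _ _ _ ↔ f.1 ∈ (homD A K m n).range :=
  Cocycle.fromSingleMk_mem_coboundaries_iff f.1 (zero_add n) n' hn' f.2 m hm

/-- The cohomology classes of degree `n` from `A` (in degree `0`) to `K`. -/
def cohomologyClassAddEquiv (A : C) (K : CochainComplex C ℤ) (m n n' : ℤ) (hm : m + 1 = n)
    (hn' : n + 1 = n') :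
    (homD A K n n').ker ⧸ (homD A K m n).range.addSubgroupOf (homD A K n n').ker ≃+
      CohomologyClass ((CochainComplex.singleFunctor C 0).obj A) K n :=
  QuotientAddGroup.congr _ _
    (AddEquiv.ofBijective (toCocycle A K n n' hn') (toCocycle_bijective A K n n' hn')) (by
    ext α
    obtain ⟨f, rfl⟩ := (toCocycle_bijective A K n n' hn').surjective α
    refine Iff.trans ?_ (toCocycle_mem_coboundaries_iff A K m n n' hm hn' f).symm
    constructor
    · rintro ⟨g, hg, hg'⟩
      obtain rfl := (toCocycle_bijective A K n n' hn').injective hg'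
      exact hg
    · exact fun hf => ⟨f, hf, rfl⟩)

/-- A criterion for an isomorphism between the cohomology classes from `A` to `K` and those
from `A'` to `K'`. -/
theorem nonempty_cohomologyClass_addEquiv {C' : Type*} [Category.{v} C'] [Abelian C'] {A : C}
    {K : CochainComplex C ℤ} {A' : C'} {K' : CochainComplex C' ℤ} (n : ℤ)
    (φ : ∀ i, (A ⟶ K.X i) →+ (A' ⟶ K'.X i))
    (hφ : ∀ i j (f : A ⟶ K.X i), φ j (f ≫ K.d i j) = φ i f ≫ K'.d i j)
    (hsurj : ∀ f : A' ⟶ K'.X n, f ≫ K'.d n (n + 1) = 0 → ∃ g : A ⟶ K.X n, g ≫ K.d n (n + 1) = 0 ∧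
      ∃ h : A' ⟶ K'.X (n - 1), h ≫ K'.d (n - 1) n = φ n g - f)
    (hinj : ∀ f : A ⟶ K.X n, f ≫ K.d n (n + 1) = 0 →
      ∀ h : A' ⟶ K'.X (n - 1), h ≫ K'.d (n - 1) n = φ n f →
        ∃ h' : A ⟶ K.X (n - 1), h' ≫ K.d (n - 1) n = f) :
    Nonempty (CohomologyClass ((CochainComplex.singleFunctor C 0).obj A) K n ≃+
      CohomologyClass ((CochainComplex.singleFunctor C' 0).obj A') K' n) := by
  obtain ⟨e⟩ := nonempty_subquotient_addEquiv (φ n) (homD A K n (n + 1)).ker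
    (homD A K (n - 1) n).range (homD A' K' n (n + 1)).ker (homD A' K' (n - 1) n).range
    (fun f hf => (hφ n (n + 1) f).symm.trans ((congrArg _ hf).trans (map_zero _)))
    (fun f hf => hsurj f hf) (fun f hf => ⟨fun ⟨h, hh⟩ => hinj f hf h hh, by
      rintro ⟨h, rfl⟩
      exact ⟨φ _ h, (hφ _ _ _).symm⟩⟩)
  exact ⟨(cohomologyClassAddEquiv A K (n - 1) n (n + 1) (by lia) rfl).symm.trans
    (e.trans (cohomologyClassAddEquiv A' K' (n - 1) n (n + 1) (by lia) rfl))⟩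

theorem nonempty_cohomologyClass_addEquiv_of_equiv {C' : Type*} [Category.{v} C'] [Abelian C']
    {A : C} {K : CochainComplex C ℤ} {A' : C'} {K' : CochainComplex C' ℤ} (n : ℤ)
    (φ : ∀ i, (A ⟶ K.X i) ≃+ (A' ⟶ K'.X i))
    (hφ : ∀ i j (f : A ⟶ K.X i), φ j (f ≫ K.d i j) = φ i f ≫ K'.d i j) :
    Nonempty (CohomologyClass ((CochainComplex.singleFunctor C 0).obj A) K n ≃+
      CohomologyClass ((CochainComplex.singleFunctor C' 0).obj A') K' n) := by
  refine nonempty_cohomologyClass_addEquiv n (fun i => (φ i).toAddMonoidHom) hφ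
    -- Cocycles lift exactly, so the correcting coboundary is that of `0`.
    (fun f hf => ⟨(φ n).symm f, ?_, 0, ?_⟩) (fun f _ h hh => ⟨(φ _).symm h, ?_⟩)
  · refine (φ _).injective ((hφ _ _ _).trans ?_)
    rw [AddEquiv.apply_symm_apply, hf, map_zero]
  · simp
  · refine (φ _).injective ((hφ _ _ _).trans ?_)
    rw [AddEquiv.apply_symm_apply, hh]
    rfl

end HomCohomology

/-! ### Complexes with acyclic terms -/

section Acyclic

open CochainComplex HomComplex Abelian DerivedCategory

universe v w w'

variable {C : Type*} [Category.{v} C] [Abelian C]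

theorem exists_lift_of_subsingleton_ext [HasExt.{w'} C] (A : C) {S : ShortComplex C}
    (hS : S.ShortExact) (h : Subsingleton (Ext A S.X₁ 1)) (f : A ⟶ S.X₃) :
    ∃ g : A ⟶ S.X₂, g ≫ S.g = f := by
  obtain ⟨x, hx⟩ := Ext.covariant_sequence_exact₃ A hS (Ext.mk₀ f) (n₁ := 1) rfl
    (Subsingleton.elim _ _)
  obtain ⟨g, rfl⟩ := (Ext.mk₀_bijective A S.X₂).surjective x
  exact ⟨g, (Ext.mk₀_bijective A S.X₃).injective (by rw [← hx, Ext.mk₀_comp_mk₀])⟩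

theorem subsingleton_ext_X₃ [HasExt.{w'} C] (A : C) {S : ShortComplex C}
    (hS : S.ShortExact) (m : ℕ) (h₁ : Subsingleton (Ext A S.X₁ (m + 1)))
    (h₂ : Subsingleton (Ext A S.X₂ m)) : Subsingleton (Ext A S.X₃ m) := by
  refine subsingleton_of_forall_eq 0 fun x => ?_
  obtain ⟨y, rfl⟩ := Ext.covariant_sequence_exact₃ A hS x rfl (Subsingleton.elim _ _)
  rw [Subsingleton.elim y 0, Ext.zero_comp]

theorem subsingleton_ext_of_isZero [HasExt.{w'} C] (A : C) {M : C} (hM : IsZero M) (m : ℕ) :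
    Subsingleton (Ext A M m) := by
  refine subsingleton_of_forall_eq 0 fun x => ?_
  rw [← Ext.comp_mk₀_id x, hM.eq_of_src (𝟙 M) 0, Ext.mk₀_zero, Ext.comp_zero]

/-- The short exact sequence `0 ⟶ Zⁱ ⟶ Kⁱ ⟶ Zʲ ⟶ 0` of an acyclic complex. -/
def cyclesShortComplex (K : CochainComplex C ℤ) (i j : ℤ) : ShortComplex C :=
  ShortComplex.mk (K.iCycles i) (K.toCycles i j) (by
    rw [← cancel_mono (K.iCycles j), Category.assoc, K.toCycles_i, K.iCycles_d, zero_comp])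

theorem cyclesShortComplex_shortExact (K : CochainComplex C ℤ) (i j : ℤ) (hij : i + 1 = j)
    (h : K.ExactAt j) : (cyclesShortComplex K i j).ShortExact where
  exact := by
    have h₁ : (ShortComplex.mk (K.iCycles i) (K.d i j) (K.iCycles_d i j)).Exact :=
      ShortComplex.exact_of_f_is_kernel _ (K.cyclesIsKernel i j
        ((ComplexShape.up ℤ).next_eq' (by simpa using hij)))
    let φ : cyclesShortComplex K i j ⟶ ShortComplex.mk (K.iCycles i) (K.d i j)
      (K.iCycles_d i j) :=
        { τ₁ := 𝟙 _
          τ₂ := 𝟙 _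
          τ₃ := K.iCycles j
          comm₁₂ := (Category.id_comp _).trans (Category.comp_id _).symm
          comm₂₃ := (Category.id_comp _).trans (K.toCycles_i i j).symm }
    have : Epi φ.τ₁ := inferInstanceAs (Epi (𝟙 _))
    have : IsIso φ.τ₂ := inferInstanceAs (IsIso (𝟙 _))
    have : Mono φ.τ₃ := inferInstanceAs (Mono (K.iCycles j))
    exact (ShortComplex.exact_iff_of_epi_of_isIso_of_mono φ).2 h₁
  mono_f := inferInstanceAs (Mono (K.iCycles i))
  epi_g := by
    have hj : (ComplexShape.up ℤ).prev j = i :=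
      (ComplexShape.up ℤ).prev_eq' (by simpa using hij)
    subst hj
    exact ShortComplex.Exact.epi_toCycles h

theorem isZero_cycles_of_isZero (K : CochainComplex C ℤ) (i : ℤ) (h : IsZero (K.X i)) :
    IsZero (K.cycles i) := by
  rw [IsZero.iff_id_eq_zero, ← cancel_mono (K.iCycles i)]
  exact h.eq_of_tgt _ _

/-- Induction upwards along `0 ⟶ Zⁱ ⟶ Kⁱ ⟶ Zⁱ⁺¹ ⟶ 0`, starting below `d`, where the cycles vanish.
Each step uses the vanishing of `Ext^{m+1}(A, Zⁱ)`, so `m` has to vary in the induction. -/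
theorem subsingleton_ext_cycles [HasExt.{w'} C] (A : C) (K : CochainComplex C ℤ) (d : ℤ)
    [K.IsStrictlyGE d] (hK : ∀ i, K.ExactAt i)
    (h : ∀ i m, 0 < m → Subsingleton (Ext A (K.X i) m)) (i : ℤ) (m : ℕ) (hm : 0 < m) :
    Subsingleton (Ext A (K.cycles i) m) := by
  obtain hi | hi := lt_or_ge i d
  · exact subsingleton_ext_of_isZero A
      (isZero_cycles_of_isZero K i (K.isZero_of_isStrictlyGE d i hi)) m
  · obtain ⟨k, rfl⟩ := Int.le.dest hi
    clear hi
    induction k generalizing m with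
    | zero =>
      refine subsingleton_ext_X₃ A (cyclesShortComplex_shortExact K (d - 1) _ (by lia) (hK _)) m
        (subsingleton_ext_of_isZero A (isZero_cycles_of_isZero K (d - 1)
          (K.isZero_of_isStrictlyGE d (d - 1) (by lia))) _) (h _ m hm)
    | succ k hk =>
      exact subsingleton_ext_X₃ A (cyclesShortComplex_shortExact K (d + k) _ (by lia) (hK _)) m
        (hk (m + 1) (by lia)) (h _ m hm)

/-- The complex `Hom(A, K)` is exact: a cocycle factors through `Zʲ` and lifts to `Kⁱ` because
`Ext¹(A, Zⁱ) = 0`. -/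
theorem exists_comp_d_eq [HasExt.{w'} C] (A : C) (K : CochainComplex C ℤ) (d : ℤ)
    [K.IsStrictlyGE d] (hK : ∀ i, K.ExactAt i)
    (h : ∀ i m, 0 < m → Subsingleton (Ext A (K.X i) m)) (i j k : ℤ) (hij : i + 1 = j)
    (hjk : j + 1 = k) (f : A ⟶ K.X j) (hf : f ≫ K.d j k = 0) :
    ∃ g : A ⟶ K.X i, g ≫ K.d i j = f := by
  obtain ⟨g, hg⟩ := exists_lift_of_subsingleton_ext A
    (cyclesShortComplex_shortExact K i j hij (hK j))
    (subsingleton_ext_cycles A K d hK h i 1 one_pos)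
    (K.liftCycles f k ((ComplexShape.up ℤ).next_eq' (by simpa using hjk)) hf)
  let g' : A ⟶ K.X i := g
  have hg' : g' ≫ K.toCycles i j = K.liftCycles f k _ hf := hg
  refine ⟨g', ?_⟩
  rw [← K.toCycles_i, reassoc_of% hg', K.liftCycles_i]

theorem exactAt_X₃_of_quasiIso {S : ShortComplex (CochainComplex C ℤ)} (hS : S.ShortExact)
    [QuasiIso S.f] (i : ℤ) : S.X₃.ExactAt i := by
  rw [HomologicalComplex.exactAt_iff_isZero_homology]
  have hi : (ComplexShape.up ℤ).Rel i (i + 1) := rfl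
  refine (hS.homology_exact₃ i (i + 1) hi).isZero_X₂ ?_ ?_
  · exact (hS.homology_exact₂ i).epi_f_iff.1 (inferInstanceAs (Epi
      (HomologicalComplex.homologyMap S.f i)))
  · exact (hS.homology_exact₁ i (i + 1) hi).mono_g_iff.1 (inferInstanceAs (Mono
      (HomologicalComplex.homologyMap S.f (i + 1))))

/-- The quotient `L/K` is exact with `Hom(A, -)`-acyclic terms, so `Hom(A, L/K)` is exact. As
`Ext¹(A, Kⁱ) = 0`, it is the quotient of `Hom(A, L)` by `Hom(A, K)`, and these two have the same
cohomology. -/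
theorem nonempty_cohomologyClass_addEquiv_injective [HasExt.{w'} C] (A : C)
    {K L : CochainComplex C ℤ} (ι : K ⟶ L) [Mono ι] [QuasiIso ι] (d : ℤ) [L.IsStrictlyGE d]
    (hL : ∀ i, Injective (L.X i)) (hK : ∀ i m, 0 < m → Subsingleton (Ext A (K.X i) m)) (n : ℤ) :
    Nonempty (CohomologyClass ((CochainComplex.singleFunctor C 0).obj A) K n ≃+
      CohomologyClass ((CochainComplex.singleFunctor C 0).obj A) L n) := by
  let S : ShortComplex (CochainComplex C ℤ) :=
    ShortComplex.mk ι (cokernel.π ι) (cokernel.condition ι)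
  have hS : S.ShortExact :=
    { exact := ShortComplex.exact_of_g_is_cokernel _ (cokernelIsCokernel ι)
      mono_f := inferInstanceAs (Mono ι)
      epi_g := inferInstanceAs (Epi (cokernel.π ι)) }
  have hSi (i : ℤ) := hS.map_of_exact (HomologicalComplex.eval C (.up ℤ) i)
  have : QuasiIso S.f := inferInstanceAs (QuasiIso ι)
  have hex := exactAt_X₃_of_quasiIso hS
  have hext (i m) (hm : 0 < m) : Subsingleton (Ext A (S.X₃.X i) m) := by
    obtain ⟨m, rfl⟩ := Nat.exists_eq_succ_of_ne_zero hm.ne'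
    exact subsingleton_ext_X₃ A (hSi i) _ (hK i _ (by lia))
      (Ext.subsingleton_of_injective A (L.X i) m)
  have hlift (i : ℤ) : ∀ f : A ⟶ S.X₃.X i, ∃ g : A ⟶ L.X i, g ≫ S.g.f i = f :=
    exists_lift_of_subsingleton_ext A (hSi i) (hK i 1 one_pos)
  have : S.X₃.IsStrictlyGE d := by
    rw [CochainComplex.isStrictlyGE_iff]
    intro i hi
    have : Epi (S.g.f i) := (hSi i).epi_g
    exact IsZero.of_epi (S.g.f i) (L.isZero_of_isStrictlyGE d i hi)
  have hker (i : ℤ) (f : A ⟶ L.X i) (hf : f ≫ S.g.f i = 0) : ∃ g : A ⟶ K.X i, g ≫ ι.f i = f := by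
    have := (hSi i).mono_f
    exact ⟨(hSi i).exact.lift f hf, (hSi i).exact.lift_f f hf⟩
  have hmono (i : ℤ) : Mono (ι.f i) := (hSi i).mono_f
  have hzero (i : ℤ) : ι.f i ≫ S.g.f i = 0 := (S.map (HomologicalComplex.eval C (.up ℤ) i)).zero
  refine nonempty_cohomologyClass_addEquiv n (fun i => Preadditive.rightComp A (ι.f i))
    (fun i j f => ?_) (fun f hf => ?_) fun f hf h hh => ?_
  · change (f ≫ K.d i j) ≫ ι.f j = (f ≫ ι.f i) ≫ L.d i j
    rw [Category.assoc, Category.assoc, ι.comm]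
  -- Surjectivity: modulo `K` the cocycle `f` bounds some `g`, which lifts to `L`. Then `f - dg`
  -- comes from a cocycle `y` of `K`, and `y - f = d(-g)`.
  · obtain ⟨g, hg⟩ := exists_comp_d_eq A S.X₃ d hex hext (n - 1) n (n + 1) (by lia) rfl
      (f ≫ S.g.f n) (by rw [Category.assoc, S.g.comm, reassoc_of% hf, zero_comp])
    obtain ⟨g, rfl⟩ := hlift (n - 1) g
    obtain ⟨y, hy⟩ := hker n (f - g ≫ L.d (n - 1) n) (by
      rw [Preadditive.sub_comp, ← hg, Category.assoc, Category.assoc, ← S.g.comm]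
      exact sub_self _)
    refine ⟨y, ?_, -g, ?_⟩
    · rw [← cancel_mono (ι.f (n + 1)), Category.assoc, ← ι.comm, reassoc_of% hy,
        Preadditive.sub_comp, hf, Category.assoc, L.d_comp_d, comp_zero, sub_zero, zero_comp]
    · change _ = y ≫ ι.f n - f
      rw [hy, Preadditive.neg_comp, sub_sub_cancel_left]
  · change h ≫ L.d (n - 1) n = f ≫ ι.f n at hh
    -- Injectivity: `dh` lies in `K`, so `h` is a cocycle modulo `K`, hence a coboundary there.
    -- Subtracting `dg` moves `h` into `K` without changing `dh`.
    obtain ⟨g, hg⟩ := exists_comp_d_eq A S.X₃ d hex hext (n - 2) (n - 1) n (by lia) (by lia)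
      (h ≫ S.g.f (n - 1)) (by rw [Category.assoc, S.g.comm, reassoc_of% hh, hzero, comp_zero])
    obtain ⟨g, rfl⟩ := hlift (n - 2) g
    obtain ⟨y, hy⟩ := hker (n - 1) (h - g ≫ L.d (n - 2) (n - 1)) (by
      rw [Preadditive.sub_comp, ← hg, Category.assoc, Category.assoc, ← S.g.comm]
      exact sub_self _)
    refine ⟨y, ?_⟩
    rw [← cancel_mono (ι.f n), Category.assoc, ← ι.comm, reassoc_of% hy,
      Preadditive.sub_comp, hh, Category.assoc, L.d_comp_d, comp_zero, sub_zero]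

variable [HasDerivedCategory.{w} C]

theorem nonempty_cohomologyClass_addEquiv_hom (A : C) (L : CochainComplex C ℤ)
    [L.IsKInjective] (n : ℤ) :
    Nonempty (CohomologyClass ((CochainComplex.singleFunctor C 0).obj A) L n ≃+
      ((DerivedCategory.singleFunctor C 0).obj A ⟶ (Q.obj L)⟦n⟧)) := by
  let e₁ := CohomologyClass.homAddEquiv
    (K := (CochainComplex.singleFunctor C 0).obj A) (L := L) (n := n)
  let e₂ : ((HomotopyCategory.quotient C (.up ℤ)).obj
      ((CochainComplex.singleFunctor C 0).obj A) ⟶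
      (HomotopyCategory.quotient C (.up ℤ)).obj (L⟦n⟧)) ≃+ _ :=
    AddEquiv.ofBijective (Functor.mapAddHom Qh)
      (CochainComplex.IsKInjective.Qh_map_bijective _ (L⟦n⟧))
  let e₃ : Qh.obj ((HomotopyCategory.quotient C (.up ℤ)).obj (L⟦n⟧)) ≅ (Q.obj L)⟦n⟧ :=
    (quotientCompQhIso C).app _ ≪≫ (Q.commShiftIso n).app L
  exact ⟨e₁.trans (e₂.trans (postcompAddEquiv _ e₃))⟩

/-- Acyclic terms compute derived morphisms as well as injective ones do: embed `K`
quasi-isomorphically in a complex of injectives and compare. -/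
theorem nonempty_cohomologyClass_addEquiv_hom_of_acyclic [HasExt.{w'} C] [EnoughInjectives C]
    (A : C) (K : CochainComplex C ℤ) [K.IsStrictlyGE 0]
    (hK : ∀ i m, 0 < m → Subsingleton (Ext A (K.X i) m)) (n : ℤ) :
    Nonempty (CohomologyClass ((CochainComplex.singleFunctor C 0).obj A) K n ≃+
      ((DerivedCategory.singleFunctor C 0).obj A ⟶ (Q.obj K)⟦n⟧)) := by
  obtain ⟨L, ι, _, _, hL, _⟩ :=
    CochainComplex.Plus.modelCategoryQuillen.exists_mono_quasiIso_injective K (-1) 0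
  have := CochainComplex.isKInjective_of_injective L (-1)
  obtain ⟨e₁⟩ := nonempty_cohomologyClass_addEquiv_injective A ι (-1) hL hK n
  obtain ⟨e₂⟩ := nonempty_cohomologyClass_addEquiv_hom A L n
  exact ⟨e₁.trans (e₂.trans (postcompAddEquiv _
    ((CategoryTheory.shiftFunctor _ n).mapIso (asIso (Q.map ι)).symm)))⟩

end Acyclic

/-! ### The Grothendieck spectral sequence -/

section Extend

variable {ι ι' : Type*} {c : ComplexShape ι} {c' : ComplexShape ι'} {C D : Type*} [Category* C]
  [Category* D] [HasZeroObject C] [HasZeroMorphisms C] [HasZeroObject D] [HasZeroMorphisms D]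

/-- The degreewise comparison between applying a functor and extending a complex by zero. -/
def mapExtendXIso (F : C ⥤ D) [F.PreservesZeroMorphisms] (K : HomologicalComplex C c) :
    ∀ i : Option ι, F.obj (HomologicalComplex.extend.X K i) ≅
      HomologicalComplex.extend.X ((F.mapHomologicalComplex c).obj K) i
  | some _ => Iso.refl _
  | none => (F.map_isZero (isZero_zero C)).iso (isZero_zero D)

theorem mapExtendXIso_hom_d (F : C ⥤ D) [F.PreservesZeroMorphisms] (K : HomologicalComplex C c)
    (i j : Option ι) :
    (mapExtendXIso F K i).hom ≫
        HomologicalComplex.extend.d ((F.mapHomologicalComplex c).obj K) i j =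
      F.map (HomologicalComplex.extend.d K i j) ≫ (mapExtendXIso F K j).hom := by
  cases i with
  | none => simp [HomologicalComplex.extend.d_none_eq_zero]
  | some i =>
    cases j with
    | none => simp [HomologicalComplex.extend.d_none_eq_zero']
    | some j => exact (Category.id_comp _).trans (Category.comp_id _).symm

/-- Extension of complexes by zero commutes with functors which preserve zero morphisms. -/
def mapExtendIso (F : C ⥤ D) [F.PreservesZeroMorphisms] (K : HomologicalComplex C c)
    (e : c.Embedding c') :
    (F.mapHomologicalComplex c').obj (K.extend e) ≅
      ((F.mapHomologicalComplex c).obj K).extend e :=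
  HomologicalComplex.Hom.isoOfComponents (fun i => mapExtendXIso F K (e.r i))
    fun i j _ => mapExtendXIso_hom_d F K (e.r i) (e.r j)

end Extend

section Grothendieck

variable {𝒜 ℬ : Type*} [Category.{u} 𝒜] [Category.{u} ℬ] [Abelian 𝒜] [Abelian ℬ]

theorem nonempty_homology_mapHomologicalComplex_iso_rightDerived [HasInjectiveResolutions 𝒜]
    (F : 𝒜 ⥤ ℬ) [F.Additive] {J : 𝒜}
    (R : InjectiveResolution J) (q : ℕ) :
    Nonempty (((F.mapHomologicalComplex (.up ℤ)).obj R.cochainComplex).homology (q : ℤ) ≅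
      (F.rightDerived q).obj J) :=
  ⟨HomologicalComplex.homologyMapIso
      (mapExtendIso F R.cocomplex ComplexShape.embeddingUpNat) (q : ℤ) ≪≫
    ((F.mapHomologicalComplex (.up ℕ)).obj R.cocomplex).extendHomologyIso
      ComplexShape.embeddingUpNat (j := q) rfl ≪≫ (R.isoRightDerivedObj F q).symm⟩

/-- Postcomposition with an isomorphism, on `Ext`-groups. -/
def extPostcompAddEquiv [HasExt.{u} ℬ] (S : ℬ) {M N : ℬ} (e : M ≅ N) (p : ℕ) :
    Abelian.Ext S M p ≃+ Abelian.Ext S N p where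
  toFun x := x.comp (Abelian.Ext.mk₀ e.hom) (add_zero p)
  invFun x := x.comp (Abelian.Ext.mk₀ e.inv) (add_zero p)
  left_inv x := by simp
  right_inv x := by simp
  map_add' x y := by simp

/-- The second functor is `Hom(S, -)`, and `φ` identifies its composition with `F` with `Hom(G, -)`,
so that both the second page and the abutment are `Ext`-groups. -/
theorem exists_grothendieck_spectralSequence [EnoughInjectives 𝒜] [EnoughInjectives ℬ]
    [HasExt.{u} 𝒜] [HasExt.{u} ℬ] (F : 𝒜 ⥤ ℬ) [F.Additive] (G : 𝒜) (S : ℬ)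
    (φ : ∀ M : 𝒜, (G ⟶ M) ≃+ (S ⟶ F.obj M))
    (hφ : ∀ (M M' : 𝒜) (g : M ⟶ M') (f : G ⟶ M), φ M' (f ≫ g) = φ M f ≫ F.map g)
    (hF : ∀ (I : 𝒜) [Injective I] (m : ℕ), 0 < m → Subsingleton (Abelian.Ext S (F.obj I) m))
    (J : 𝒜) :
    ∃ E : E₂CohomologicalSpectralSequenceNat Ab.{u},
      (∀ p q : ℕ, Nonempty
        ((E.page 2 le_rfl).X (p, q) ≃+ Abelian.Ext S ((F.rightDerived q).obj J) p)) ∧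
      ConvergesTo E (fun n => Abelian.Ext G J n) := by
  let := HasDerivedCategory.standard ℬ
  let R := injectiveResolution J
  let K : CochainComplex ℬ ℤ := (F.mapHomologicalComplex (.up ℤ)).obj R.cochainComplex
  have hK₀ : K.IsStrictlyGE 0 := inferInstance
  have hK (i : ℤ) (m : ℕ) (hm : 0 < m) : Subsingleton (Abelian.Ext S (K.X i) m) :=
    hF (R.cochainComplex.X i) m hm
  have : (DerivedCategory.Q.obj K).IsGE 0 := inferInstance
  refine ⟨(homSpectralObject S (DerivedCategory.Q.obj K)).E₂SpectralSequenceNat,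
    fun p q => ?_, convergesTo_homSpectralObject _ _ _ fun n => ?_⟩
  · obtain ⟨e⟩ := nonempty_page_two_addEquiv_ext S (DerivedCategory.Q.obj K) p q
    obtain ⟨e'⟩ := nonempty_homology_mapHomologicalComplex_iso_rightDerived F R q
    exact ⟨e.trans (extPostcompAddEquiv S
      ((DerivedCategory.homologyFunctorFactors ℬ (q : ℤ)).app K ≪≫ e') p)⟩
  -- `Ext^n(G, J)` is `H^n` of `Hom(G, R)`, which is `Hom(S, K)` by `φ`, whose cohomology is `Hom(S,
  -- K[n])` by acyclicity.
  · obtain e₁ := R.extAddEquivCohomologyClass (X := G) (n := n)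
    have e₂ := nonempty_cohomologyClass_addEquiv_of_equiv (A := G) (K := R.cochainComplex)
      (A' := S) (K' := K) (n : ℤ) (fun i => φ _) (fun i j f => hφ _ _ _ _)
    have e₃ := nonempty_cohomologyClass_addEquiv_hom_of_acyclic S K hK (n : ℤ)
    exact ((e₁.trans e₂.some).trans e₃.some).symm

end Grothendieck

/-! ### Exactness of the forgetful functor to abelian sheaves -/

theorem nonempty_rightDerived_comp_iso {𝒜 ℬ 𝒞 : Type*} [Category* 𝒜] [Category* ℬ] [Category* 𝒞]
    [Abelian 𝒜] [Abelian ℬ] [Abelian 𝒞] [HasInjectiveResolutions 𝒜] (F : 𝒜 ⥤ ℬ) [F.Additive]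
    (T : ℬ ⥤ 𝒞) [T.Additive] [PreservesFiniteLimits T] [PreservesFiniteColimits T] (q : ℕ) (J : 𝒜) :
    Nonempty (((F ⋙ T).rightDerived q).obj J ≅ T.obj ((F.rightDerived q).obj J)) := by
  let R := injectiveResolution J
  let K := (F.mapHomologicalComplex (.up ℕ)).obj R.cocomplex
  exact ⟨R.isoRightDerivedObj (F ⋙ T) q ≪≫ (K.sc q).mapHomologyIso T ≪≫
    T.mapIso (R.isoRightDerivedObj F q).symm⟩

/-- A functor out of a category with a reflector preserves the colimits which its composition with
the reflector preserves. -/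
theorem preservesColimitsOfShape_of_reflection {𝓟 ℬ 𝒞 K : Type*} [Category* 𝓟] [Category* ℬ]
    [Category* 𝒞] [Category* K] {a : 𝓟 ⥤ ℬ} {i : ℬ ⥤ 𝓟} (adj : a ⊣ i) [IsIso adj.counit]
    [HasColimitsOfShape K 𝓟] (T : ℬ ⥤ 𝒞) [PreservesColimitsOfShape K (a ⋙ T)] :
    PreservesColimitsOfShape K T where
  preservesColimit {D} := by
    -- By the counit, `D` is the reflection of the diagram `D ⋙ i`, so its colimit is the reflection
    -- of a colimit in `𝓟`.
    have := adj.leftAdjoint_preservesColimits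
    have : PreservesColimit (D ⋙ i ⋙ a) T := show PreservesColimit ((D ⋙ i) ⋙ a) T from
      preservesColimit_of_preserves_colimit_cocone
        (isColimitOfPreserves a (colimit.isColimit (D ⋙ i)))
        (isColimitOfPreserves (a ⋙ T) (colimit.isColimit (D ⋙ i)))
    exact preservesColimit_of_iso_diagram T
      (Functor.isoWhiskerLeft D (asIso adj.counit) ≪≫ D.rightUnitor)

/-- Sheafifying a presheaf of modules and then forgetting the action is the same as forgetting first
and sheafifying the abelian presheaf; the latter preserves colimits. -/
instance preservesFiniteColimits_toSheaf (X : Scheme.{u}) :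
    PreservesFiniteColimits (SheafOfModules.toSheaf.{u} X.ringCatSheaf) where
  preservesFiniteColimits K _ _ := by
    have : PreservesColimitsOfShape K (PresheafOfModules.sheafification.{u}
        (𝟙 X.ringCatSheaf.obj) ⋙ SheafOfModules.toSheaf X.ringCatSheaf) :=
      inferInstanceAs (PreservesColimitsOfShape K
        (PresheafOfModules.toPresheaf.{u} X.ringCatSheaf.obj ⋙
          presheafToSheaf (Opens.grothendieckTopology X) AddCommGrpCat.{u}))
    exact preservesColimitsOfShape_of_reflection (K := K)
      (a := PresheafOfModules.sheafification.{u} (𝟙 X.ringCatSheaf.obj))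
      (PresheafOfModules.sheafificationAdjunction.{u} (𝟙 X.ringCatSheaf.obj))
      (SheafOfModules.toSheaf X.ringCatSheaf)

/-! ### Flasque sheaves -/

/-- A criterion for the vanishing of `Ext`-groups by dimension shifting. -/
theorem subsingleton_ext_succ_of_cokernel_injective {C : Type*} [Category* C] [Abelian C]
    [EnoughInjectives C] [HasExt.{u} C] (A : C) (P : C → Prop)
    (hP : ∀ (S : ShortComplex C), S.ShortExact → Injective S.X₂ → P S.X₁ →
      P S.X₃ ∧ ∀ f : A ⟶ S.X₃, ∃ g : A ⟶ S.X₂, g ≫ S.g = f)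
    (n : ℕ) (M : C) (hM : P M) : Subsingleton (Abelian.Ext A M (n + 1)) := by
  induction n generalizing M with
  | zero =>
    let i := (EnoughInjectives.presentation M).some
    have : Injective i.shortComplex.X₂ := inferInstanceAs (Injective i.J)
    obtain ⟨-, h⟩ := hP _ i.shortExact_shortComplex this hM
    refine subsingleton_of_forall_eq 0 fun x => ?_
    -- `x` dies in the `Ext¹` of the injective object, so it is the image of some `f` under the
    -- connecting map; `f` lifts to the injective object, so that image is zero.
    obtain ⟨y, rfl⟩ := Abelian.Ext.covariant_sequence_exact₁ _ i.shortExact_shortComplex x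
      (Abelian.Ext.eq_zero_of_injective _) rfl
    obtain ⟨f, rfl⟩ := (Abelian.Ext.mk₀_bijective _ _).surjective y
    obtain ⟨g, rfl⟩ := h f
    rw [← Abelian.Ext.mk₀_comp_mk₀, Abelian.Ext.comp_assoc_of_second_deg_zero,
      ShortComplex.ShortExact.comp_extClass, Abelian.Ext.comp_zero]
  | succ n ih =>
    let i := (EnoughInjectives.presentation M).some
    have : Injective i.shortComplex.X₂ := inferInstanceAs (Injective i.J)
    have h := ih _ (hP _ i.shortExact_shortComplex this hM).1
    refine subsingleton_of_forall_eq 0 fun x => ?_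
    obtain ⟨y, rfl⟩ := Abelian.Ext.covariant_sequence_exact₁ _ i.shortExact_shortComplex x
      (Abelian.Ext.eq_zero_of_injective _) rfl
    rw [Subsingleton.elim y 0, Abelian.Ext.zero_comp]

section Flasque

variable {X : TopCat.{u}}

/-- Right adjoints of functors preserving monomorphisms preserve injectives, so `I` is injective as
a presheaf of sets. A section is a morphism from a representable presheaf, and it extends along the
inclusion of representables. -/
theorem isFlasque_of_injective (I : Sheaf (Opens.grothendieckTopology X) Ab.{u})
    [hI : Injective I] : TopCat.Sheaf.IsFlasque I where
  epi {U V} i := by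
    let adj := (AddCommGrpCat.adj.{u}.whiskerRight (Opens X)ᵒᵖ)
    have h₁ : Injective ((sheafToPresheaf (Opens.grothendieckTopology X) Ab.{u}).obj I) :=
      (sheafificationAdjunction _ _).map_injective I hI
    let P : (Opens X)ᵒᵖ ⥤ Type u := I.obj ⋙ forget Ab
    have h₂ : Injective P := adj.map_injective _ h₁
    rw [AddCommGrpCat.epi_iff_surjective]
    intro s
    let t : yoneda.obj V.unop ⟶ P := yonedaEquiv.symm s
    refine ⟨yonedaEquiv (Injective.factorThru t (yoneda.map i.unop)), ?_⟩
    have h := yonedaEquiv_naturality (Injective.factorThru t (yoneda.map i.unop)) i.unop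
    rw [Injective.comp_factorThru, Equiv.apply_symm_apply] at h
    exact h

variable (X) in
/-- The constant abelian sheaf `ℤ`. -/
abbrev constantInt : Sheaf (Opens.grothendieckTopology X) Ab.{u} :=
  (constantSheaf (Opens.grothendieckTopology X) Ab.{u}).obj (AddCommGrpCat.of (ULift ℤ))

/-- Morphisms from the constant sheaf `ℤ` are global sections. -/
def constantIntHomEquiv (F : Sheaf (Opens.grothendieckTopology X) Ab.{u}) :
    (constantInt X ⟶ F) ≃+ F.obj.obj (op ⊤) :=
  ((constantSheafAdj _ AddCommGrpCat (Preorder.isTerminalTop (Opens X))).homAddEquiv _ F).trans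
      (AddCommGrpCat.uliftZMultiplesAddEquiv _)

theorem constantIntHomEquiv_comp {F G : Sheaf (Opens.grothendieckTopology X) Ab.{u}}
    (f : constantInt X ⟶ F) (g : F ⟶ G) :
    constantIntHomEquiv G (f ≫ g) = g.hom.app (op ⊤) (constantIntHomEquiv F f) :=
  rfl

/-- Dimension shifting: the cokernel of a flasque sheaf in an injective one is flasque, and global
sections stay surjective onto it. -/
theorem subsingleton_ext_constantInt_of_isFlasque (n : ℕ)
    (F : Sheaf (Opens.grothendieckTopology X) Ab.{u}) (hF : TopCat.Sheaf.IsFlasque F) :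
    Subsingleton (Abelian.Ext (constantInt X) F (n + 1)) := by
  refine subsingleton_ext_succ_of_cokernel_injective (constantInt X)
    (fun F => TopCat.Sheaf.IsFlasque F) (fun S hS hI hF => ⟨?_, fun f => ?_⟩) n F hF
  · have : TopCat.Sheaf.IsFlasque S.X₂ := isFlasque_of_injective S.X₂
    exact TopCat.Sheaf.IsFlasque.of_shortExact_of_isFlasque₁₂ hS
  · have h : Epi (S.g.hom.app (op (⊤ : Opens X))) := TopCat.Sheaf.IsFlasque.epi_of_shortExact hS
    rw [AddCommGrpCat.epi_iff_surjective] at h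
    obtain ⟨s, hs⟩ := h (constantIntHomEquiv _ f)
    refine ⟨(constantIntHomEquiv _).symm s, (constantIntHomEquiv _).injective ?_⟩
    rw [constantIntHomEquiv_comp, AddEquiv.apply_symm_apply, hs]

end Flasque

/-! ### Sections of `ℋom(G, M)` for injective `M` -/

section SheafHom

variable {X Y : Scheme.{u}}

/-- The subpresheaf of modules of `G` which is `G` on the open subsets of `V` and zero on the other
open subsets. -/
def extendByZero (G : X.Modules) (V : X.Opens) : G.val.Submodule where
  -- A supremum over a proposition: `⊤` if it holds and `⊥` otherwise.
  obj W := ⨆ _ : W.unop ≤ V, ⊤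
  map {W W'} i := iSup_le fun h => by
    rw [iSup_pos (i.unop.le.trans h)]
    exact le_top

theorem extendByZero_obj_of_le (G : X.Modules) {V : X.Opens} {W : (Opens X)ᵒᵖ} (h : W.unop ≤ V) :
    (extendByZero G V).obj W = ⊤ :=
  iSup_pos h

theorem extendByZero_eq_zero_of_not_le (G : X.Modules) {V : X.Opens} {W : (Opens X)ᵒᵖ}
    (h : ¬ W.unop ≤ V) (s : (extendByZero G V).obj W) : s.1 = 0 :=
  (Submodule.mem_bot _).1 ((iSup_neg h : (extendByZero G V).obj W = ⊥).le s.2)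

open Classical in
/-- The components of a section of `ℋom(G, M)` over `V`, extended by zero to the open subsets which
are not contained in `V`. -/
def extendByZeroApp {G M : X.Modules} {V : X.Opens} (φ : localHom G M V) (W : X.Opens) :
    Γ(G, W) →ₗ[Γ(X, W)] Γ(M, W) :=
  if h : W ≤ V then φ.1 ⟨W, h⟩ else 0

theorem extendByZeroApp_of_le {G M : X.Modules} {V : X.Opens} (φ : localHom G M V) {W : X.Opens}
    (h : W ≤ V) : extendByZeroApp φ W = φ.1 ⟨W, h⟩ :=
  dif_pos h

/-- The condition `hs` is what saves naturality when `W' ≤ V` but not `W ≤ V`; it holds for sections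
of `extendByZero G V`. -/
theorem extendByZeroApp_naturality {G M : X.Modules} {V : X.Opens} (φ : localHom G M V)
    {W W' : X.Opens} (i : W' ⟶ W) (s : Γ(G, W)) (hs : ¬ W ≤ V → s = 0) :
    extendByZeroApp φ W' (G.presheaf.map i.op s) =
      M.presheaf.map i.op (extendByZeroApp φ W s) := by
  by_cases h : W ≤ V
  · rw [extendByZeroApp_of_le φ h, extendByZeroApp_of_le φ (i.le.trans h)]
    exact φ.2 ⟨W, h⟩ ⟨W', i.le.trans h⟩ i s
  · rw [hs h]
    simp only [map_zero]

/-- The morphism of presheaves of modules on the extension by zero of `G|_V` which is defined by a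
section of `ℋom(G, M)` over `V`. -/
def extendByZeroDesc {G M : X.Modules} {V : X.Opens} (φ : localHom G M V) :
    (extendByZero G V).toPresheafOfModules ⟶ M.val :=
  PresheafOfModules.homMk
    { app W := AddCommGrpCat.ofHom ((extendByZeroApp φ W.unop).toAddMonoidHom.comp
        ((extendByZero G V).obj W).subtype.toAddMonoidHom)
      naturality W W' i := by
        ext x
        exact extendByZeroApp_naturality φ i.unop x.1 fun h =>
          extendByZero_eq_zero_of_not_le G h x }
    fun W r x => (extendByZeroApp φ W.unop).map_smul r x.1

/-- The section of `ℋom(G, M)` over an open subset defined by a morphism `G ⟶ M`. -/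
def localHomOfHom {G M : X.Modules} (U : X.Opens) : (G ⟶ M) →+ localHom G M U where
  toFun f := ⟨fun V =>
    { toFun s := f.app V.1 s
      map_add' := by simp
      map_smul' := f.app_smul }, fun V W i s =>
      ConcreteCategory.congr_hom (f.mapPresheaf.naturality i.op) s⟩
  map_zero' := rfl
  map_add' _ _ := rfl

/-- Morphisms `G ⟶ M` are the global sections of `ℋom(G, M)`. -/
def homEquivLocalHom (G M : X.Modules) : (G ⟶ M) ≃+ localHom G M ⊤ :=
  AddEquiv.ofBijective (localHomOfHom ⊤) ⟨fun f g h => by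
      refine Scheme.Modules.hom_ext _ _ fun U => ?_
      ext s
      exact congrArg (fun φ : localHom G M ⊤ => φ.1 ⟨U, le_top⟩ s) h, fun φ => by
    refine ⟨⟨PresheafOfModules.homMk
      { app U := AddCommGrpCat.ofHom (φ.1 ⟨U.unop, le_top⟩).toAddMonoidHom
        naturality U V i := ?_ } ?_⟩, rfl⟩
    · ext s
      exact φ.2 ⟨U.unop, le_top⟩ ⟨V.unop, le_top⟩ i.unop s
    · intro U r s
      exact (φ.1 ⟨U.unop, le_top⟩).map_smul r s⟩

/-- A section over `V` is a morphism to `I` from the extension by zero of `G|_V`, a subobject of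
`G`; injectivity extends it to `G`. As `I` is also injective among presheaves of modules, the
extension by zero need not be sheafified. -/
theorem localHomRes_surjective (G I : X.Modules) [hI : Injective I] (V : X.Opens) :
    Function.Surjective (localHomRes G I (le_top : V ≤ ⊤)) := by
  intro φ
  have : Injective I.val :=
    (PresheafOfModules.sheafificationAdjunction (𝟙 X.ringCatSheaf.obj)).map_injective I hI
  let g := Injective.factorThru (extendByZeroDesc φ) (extendByZero G V).ι
  refine ⟨localHomOfHom ⊤ ⟨g⟩, Subtype.ext (funext fun W => LinearMap.ext fun s => ?_)⟩
  have h := congrArg (fun f : (extendByZero G V).toPresheafOfModules ⟶ I.val =>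
      f.app (op W.1) ⟨s, (extendByZero_obj_of_le G (W := op W.1) W.2).ge trivial⟩)
    (Injective.comp_factorThru (extendByZeroDesc φ) (extendByZero G V).ι)
  exact h.trans (LinearMap.congr_fun (extendByZeroApp_of_le φ W.2) s)

end SheafHom

/-! ### The local-to-global spectral sequence -/

section RelativeHom

variable {X Y : Scheme.{u}}

variable (Y) in
/-- The abelian sheaf underlying an `𝒪_Y`-module. -/
def toAbSheaf : Y.Modules ⥤ Sheaf (Opens.grothendieckTopology Y) Ab.{u} :=
  SheafOfModules.toSheaf Y.ringCatSheaf

instance : (toAbSheaf Y).Additive :=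
  inferInstanceAs (SheafOfModules.toSheaf Y.ringCatSheaf).Additive

instance : PreservesFiniteLimits (toAbSheaf Y) :=
  inferInstanceAs (PreservesFiniteLimits (SheafOfModules.toSheaf Y.ringCatSheaf))

instance : PreservesFiniteColimits (toAbSheaf Y) :=
  inferInstanceAs (PreservesFiniteColimits (SheafOfModules.toSheaf Y.ringCatSheaf))

/-- The functor `ℋom_f(G, -)` with values in abelian sheaves. -/
abbrev relHomSheaf (f : X ⟶ Y) (G : X.Modules) :
    X.Modules ⥤ Sheaf (Opens.grothendieckTopology Y) Ab.{u} :=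
  relHom f G ⋙ toAbSheaf Y

theorem isFlasque_relHomSheaf (f : X ⟶ Y) (G I : X.Modules) [Injective I] :
    TopCat.Sheaf.IsFlasque ((relHomSheaf f G).obj I) where
  epi {U V} i := by
    rw [AddCommGrpCat.epi_iff_surjective]
    intro s
    -- Extend the section to all of `X`, then restrict it to the preimage of `U`.
    obtain ⟨t, ht⟩ := localHomRes_surjective G I (f ⁻¹ᵁ V.unop) s
    exact ⟨localHomRes G I le_top t, ht⟩

/-- Morphisms `G ⟶ M` are the morphisms `ℤ ⟶ ℋom_f(G, M)`. -/
def homEquivRelHomSheaf (f : X ⟶ Y) (G M : X.Modules) :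
    (G ⟶ M) ≃+ (constantInt Y ⟶ (relHomSheaf f G).obj M) :=
  (homEquivLocalHom G M).trans (constantIntHomEquiv ((relHomSheaf f G).obj M)).symm

theorem homEquivRelHomSheaf_comp (f : X ⟶ Y) (G M M' : X.Modules) (α : M ⟶ M') (g : G ⟶ M) :
    homEquivRelHomSheaf f G M' (g ≫ α) =
      homEquivRelHomSheaf f G M g ≫ (relHomSheaf f G).map α := by
  have h (N : X.Modules) (g : G ⟶ N) : constantIntHomEquiv _ (homEquivRelHomSheaf f G N g) =
      homEquivLocalHom G N g :=
    AddEquiv.apply_symm_apply _ _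
  refine (constantIntHomEquiv _).injective ((h M' (g ≫ α)).trans ?_)
  rw [constantIntHomEquiv_comp, h]
  rfl

theorem exists_relExt_spectralSequence (f : X ⟶ Y) (G J : X.Modules) :
    ∃ E : E₂CohomologicalSpectralSequenceNat Ab.{u},
      (∀ p q : ℕ, Nonempty
        ((E.page 2 le_rfl).X (p, q) ≃+ cohomology (relExt f G q J) p)) ∧
      ConvergesTo E (fun n => Abelian.Ext G J n) := by
  obtain ⟨E, hE, hE'⟩ := exists_grothendieck_spectralSequence (relHomSheaf f G) G (constantInt Y)
    (homEquivRelHomSheaf f G) (homEquivRelHomSheaf_comp f G)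
    (fun I _ m hm => by
      obtain ⟨m, rfl⟩ := Nat.exists_eq_succ_of_ne_zero hm.ne'
      exact subsingleton_ext_constantInt_of_isFlasque m _ (isFlasque_relHomSheaf f G I)) J
  refine ⟨E, fun p q => ?_, hE'⟩
  obtain ⟨e⟩ := hE p q
  obtain ⟨i⟩ := nonempty_rightDerived_comp_iso (relHom f G) (toAbSheaf Y) q J
  -- Sheaf cohomology is by definition `Ext` from the constant sheaf `ℤ`.
  exact ⟨e.trans (extPostcompAddEquiv (constantInt Y) i p)⟩

end RelativeHom

end RelExt

end

theorem proposition5p1 {k : Type u} [Field k] {X Y : Scheme.{u}}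
    (sX : X ⟶ Spec (CommRingCat.of k)) (sY : Y ⟶ Spec (CommRingCat.of k))
    [LocallyOfFiniteType sX] [QuasiCompact sX] [LocallyOfFiniteType sY] [QuasiCompact sY]
    [IsNoetherian X] [IsNoetherian Y] [IsReduced X] [IsReduced Y]
    (f : X ⟶ Y)
    (hcov : ∃ (ι : Type u) (U : ι → Y.Opens), IsOpenCover U ∧ IsOpenCover (fun i => f ⁻¹ᵁ (U i)))
    (G J : X.Modules) (hG : RelExt.IsCoherent G) (hGflat : RelExt.IsFlatOver f G)
    (hJflat : RelExt.IsFlatOver f J) :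
    ∃ E : E₂CohomologicalSpectralSequenceNat Ab.{u},
      (∀ p q : ℕ, Nonempty
        ((E.page 2).X (p, q) ≃+ RelExt.cohomology (RelExt.relExt f G q J) p)) ∧
      RelExt.ConvergesTo E (fun n => Abelian.Ext G J n) :=
  RelExt.exists_relExt_spectralSequence f G J
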